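/- Let $\mathcal H_A$ and $\mathcal H_B$ be complex Hilbert spaces of arbitrary dimension and let $\Xi$ be a quantum channel from $\mathcal H_A$ to $\mathcal H_B$, that is, a completely positive, trace preserving linear map from the trace class operators on $\mathcal H_A$ to those on $\mathcal H_B$. Let $\rho_A$ be a state (a positive operator of trace one) on $\mathcal H_A$, let $\mathcal H_C$ be a complex Hilbert space, and let $\psi\in\mathcal H_C\otimes\mathcal H_A$ be any purification of $\rho_A$, i.e. $\operatorname{Tr}_C|\psi\rangle\langle\psi|=\rho_A$. Put $$\rho_B=\Xi(\rho_A),\qquad \rho_{CB}=(\mathbb 1_C\otimes\Xi)(|\psi\rangle\langle\psi|),\qquad I_c(\rho_A,\Xi)=S(\rho_B)-S(\rho_{CB}),$$ where $S(\rho)=-\operatorname{Tr}\rho\log_2\rho\in[0,\infty]$ is the von Neumann entropy. Call a state on $\mathcal H_C\otimes\mathcal H_B$ separable if it lies in the closed convex hull of the product states $\sigma\otimes\tau$, with $\sigma$ a state on $\mathcal H_C$ and $\tau$ a state on $\mathcal H_B$; in finite dimension these are exactly the finite mixtures $\sum_i p_i\,\sigma_i\otimes\tau_i$. If $\rho_{CB}$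 is separable, then $$I_c(\rho_A,\Xi)\le 0,$$ where for infinite entropies this inequality is understood as $S(\rho_B)\le S(\rho_{CB})$. -/

import Mathlib

open scoped ENNReal TensorProduct ComplexOrder

noncomputable section

namespace QInfo

universe u v w

/-- The Hilbert space tensor product: the completion of the algebraic tensor product with the inner
product `⟪c ⊗ a, c' ⊗ a'⟫ = ⟪c, c'⟫ * ⟪a, a'⟫`. -/
abbrev HilbertTensor (C : Type u) (A : Type v)
    [NormedAddCommGroup C] [InnerProductSpace ℂ C]
    [NormedAddCommGroup A] [InnerProductSpace ℂ A] : Type (max u v) :=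
  UniformSpace.Completion (C ⊗[ℂ] A)

section Trace

variable {H : Type u} [NormedAddCommGroup H] [InnerProductSpace ℂ H] [CompleteSpace H]

variable (H) in
/-- The index set of a fixed orthonormal Hilbert basis of `H`. -/
def basisIndex : Set H := (exists_hilbertBasis ℂ H).choose

variable (H) in
/-- A fixed orthonormal Hilbert basis of `H`. -/
def basis : HilbertBasis (basisIndex H) ℂ H := (exists_hilbertBasis ℂ H).choose_spec.choose

/-- The trace `∑ᵢ ⟪eᵢ, T eᵢ⟫ ∈ [0, ∞]` of a positive operator `T`. -/
def posTrace (T : H →L[ℂ] H) : ℝ≥0∞ :=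
  ∑' i, ENNReal.ofReal (inner ℂ (basis H i) (T (basis H i))).re

variable (H) in
/-- The trace class operators on `H`: the linear span of the positive operators of finite trace. -/
def traceClass : Submodule ℂ (H →L[ℂ] H) :=
  Submodule.span ℂ {T | T.IsPositive ∧ posTrace T < ∞}

/-- States (density operators): positive operators of trace one. -/
def IsState (ρ : H →L[ℂ] H) : Prop := ρ.IsPositive ∧ posTrace ρ = 1

/-- The von Neumann entropy in bits, `S(ρ) = -Tr(ρ log₂ ρ) ∈ [0, ∞]`. The operator `-ρ log₂ ρ` is
formed by the continuous functional calculus with the function `x ↦ -x log x / log 2`, which is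
continuous on `ℝ` with value `0` at `0`. For a state `ρ` the operator `-ρ log₂ ρ` is positive, since
the spectrum of `ρ` lies in `[0, 1]`. -/
def vonNeumannEntropy (ρ : H →L[ℂ] H) : ℝ≥0∞ :=
  posTrace (cfc (fun x : ℝ => Real.negMulLog x / Real.log 2) ρ)

lemma ofReal_norm_sq_eq_tsum {ι : Type*} (b : HilbertBasis ι ℂ H) (x : H) :
    ENNReal.ofReal (‖x‖ ^ 2) = ∑' i, ENNReal.ofReal (‖inner ℂ (b i) x‖ ^ 2) := by
  have h := b.hasSum_inner_mul_inner x x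
  have h2 : HasSum (fun i => ‖inner ℂ (b i) x‖ ^ 2) (‖x‖ ^ 2) := by
    have h3 := Complex.hasSum_re h
    convert h3 using 1
    · funext i
      rw [← inner_conj_symm x (b i), ← Complex.normSq_eq_conj_mul_self, Complex.ofReal_re,
        Complex.normSq_eq_norm_sq]
    · exact norm_sq_eq_re_inner (𝕜 := ℂ) x
  rw [← h2.tsum_eq, ENNReal.ofReal_tsum_of_nonneg (fun _ => by positivity) h2.summable]

lemma tsum_norm_sq_adjoint {K : Type v} [NormedAddCommGroup K] [InnerProductSpace ℂ K]
    [CompleteSpace K] {ι κ : Type*} (b : HilbertBasis ι ℂ H) (c : HilbertBasis κ ℂ K)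
    (T : H →L[ℂ] K) :
    ∑' i, ENNReal.ofReal (‖T (b i)‖ ^ 2) = ∑' k, ENNReal.ofReal (‖T.adjoint (c k)‖ ^ 2) := by
  simp_rw [ofReal_norm_sq_eq_tsum c (T _), ofReal_norm_sq_eq_tsum b (T.adjoint _)]
  rw [ENNReal.tsum_comm]
  refine tsum_congr fun k => tsum_congr fun i => ?_
  rw [ContinuousLinearMap.adjoint_inner_right, ← inner_conj_symm, RCLike.norm_conj]

lemma posTrace_conj_lt_top {K : Type v} [NormedAddCommGroup K] [InnerProductSpace ℂ K]
    [CompleteSpace K] {X : H →L[ℂ] H} (hX : X.IsPositive) (hT : posTrace X < ∞) (V : K →L[ℂ] H) :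
    posTrace (V.adjoint ∘L X ∘L V) < ∞ := by
  obtain ⟨S, rfl⟩ := CStarAlgebra.nonneg_iff_eq_star_mul_self.mp
    ((ContinuousLinearMap.nonneg_iff_isPositive X).mpr hX)
  have key : ∀ y : H, (inner ℂ y ((star S * S) y)).re = ‖S y‖ ^ 2 := fun y => by
    rw [ContinuousLinearMap.star_eq_adjoint, mul_apply_eq_comp,
      ContinuousLinearMap.adjoint_inner_right]
    exact (norm_sq_eq_re_inner (𝕜 := ℂ) (S y)).symm
  simp only [posTrace, key] at hT
  have e1 : posTrace (V.adjoint ∘L (star S * S) ∘L V) =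
      ∑' i, ENNReal.ofReal (‖(S ∘L V) (basis K i)‖ ^ 2) := by
    refine tsum_congr fun i => ?_
    rw [ContinuousLinearMap.comp_apply, ContinuousLinearMap.adjoint_inner_right]
    exact congrArg _ (key _)
  rw [e1, tsum_norm_sq_adjoint (basis K) (basis H)]
  rw [tsum_norm_sq_adjoint (basis H) (basis H)] at hT
  refine lt_of_le_of_lt ?_ (ENNReal.mul_lt_top (ENNReal.ofReal_lt_top (r := ‖V.adjoint‖ ^ 2)) hT)
  rw [← ENNReal.tsum_mul_left]
  refine ENNReal.tsum_le_tsum fun k => ?_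
  rw [← ENNReal.ofReal_mul (by positivity), ContinuousLinearMap.adjoint_comp, ← mul_pow]
  exact ENNReal.ofReal_le_ofReal
    (pow_le_pow_left₀ (norm_nonneg _) (V.adjoint.le_opNorm _) 2)

/-- Compressions `V† X W` of trace class operators are of trace class. -/
lemma conj_mem_traceClass {K : Type v} [NormedAddCommGroup K] [InnerProductSpace ℂ K]
    [CompleteSpace K] {X : H →L[ℂ] H} (hX : X ∈ traceClass H) (V W : K →L[ℂ] H) :
    V.adjoint ∘L X ∘L W ∈ traceClass K := by
  induction hX using Submodule.span_induction with
  | mem X h =>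
    obtain ⟨hp, ht⟩ := h
    have hm : ∀ U : K →L[ℂ] H, U.adjoint ∘L X ∘L U ∈ traceClass K := fun U =>
      Submodule.subset_span ⟨hp.adjoint_conj U, posTrace_conj_lt_top hp ht U⟩
    have e : V.adjoint ∘L X ∘L W = (4⁻¹ : ℂ) •
        (((V + W).adjoint ∘L X ∘L (V + W) - (V - W).adjoint ∘L X ∘L (V - W))
          - Complex.I • ((V + Complex.I • W).adjoint ∘L X ∘L (V + Complex.I • W)
            - (V - Complex.I • W).adjoint ∘L X ∘L (V - Complex.I • W))) := by
      ext x
      simp only [map_add, map_sub, map_smulₛₗ, ContinuousLinearMap.comp_apply,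
        add_apply, sub_apply,
        smul_apply, Complex.conj_I, RingHom.id_apply]
      have hI : Complex.I * Complex.I = -1 := Complex.I_mul_I
      match_scalars <;> ring_nf <;> simp <;> norm_num
    rw [e]
    exact Submodule.smul_mem _ _ (Submodule.sub_mem _ (Submodule.sub_mem _ (hm _) (hm _))
      (Submodule.smul_mem _ _ (Submodule.sub_mem _ (hm _) (hm _))))
  | zero => simp
  | add X Y _ _ hX hY => simpa using Submodule.add_mem _ hX hY
  | smul a X _ hX => simpa using Submodule.smul_mem _ a hX

/-- `|ψ⟩⟨ψ|` as a trace class operator. -/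
def pureState (ψ : H) : traceClass H :=
  ⟨InnerProductSpace.rankOne ℂ ψ ψ, by
    refine Submodule.subset_span ⟨InnerProductSpace.isPositive_rankOne_self ψ, ?_⟩
    have : posTrace (InnerProductSpace.rankOne ℂ ψ ψ) = ENNReal.ofReal (‖ψ‖ ^ 2) := by
      rw [ofReal_norm_sq_eq_tsum (basis H) ψ]
      refine tsum_congr fun i => ?_
      rw [InnerProductSpace.rankOne_apply, inner_smul_right, ← inner_conj_symm,
        ← Complex.normSq_eq_conj_mul_self, Complex.ofReal_re, Complex.normSq_eq_norm_sq]
    rw [this]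
    exact ENNReal.ofReal_lt_top⟩

end Trace

section Tensor

variable {C : Type u} {A : Type v}
  [NormedAddCommGroup C] [InnerProductSpace ℂ C] [CompleteSpace C]
  [NormedAddCommGroup A] [InnerProductSpace ℂ A] [CompleteSpace A]

/-- The operator `|c⟩ ⊗ 1 : A → C ⊗ A`, `a ↦ c ⊗ a`. -/
def ketTensor (c : C) : A →L[ℂ] HilbertTensor C A :=
  UniformSpace.Completion.toComplL ∘L
    LinearMap.mkContinuous (TensorProduct.mk ℂ C A c) ‖c‖
      (fun a => by rw [TensorProduct.mk_apply, TensorProduct.norm_tmul])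

/-- The tensor product `σ ⊗ τ` of two operators, acting on the Hilbert space tensor product. -/
def opTensor (σ : C →L[ℂ] C) (τ : A →L[ℂ] A) : HilbertTensor C A →L[ℂ] HilbertTensor C A :=
  (TensorProduct.mapL σ τ).completion

/-- The partial trace over the first factor, `Tr_C X = ∑ᵢ (⟨eᵢ| ⊗ 1) X (|eᵢ⟩ ⊗ 1)`; for trace class
`X` the sum converges in norm. -/
def partialTraceLeft (X : HilbertTensor C A →L[ℂ] HilbertTensor C A) : A →L[ℂ] A :=
  ∑' i, (ketTensor (basis C i)).adjoint ∘L X ∘L ketTensor (basis C i)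

/-- `ψ ∈ C ⊗ A` is a purification of `ρ`: `Tr_C |ψ⟩⟨ψ| = ρ`. -/
def IsPurification (ψ : HilbertTensor C A) (ρ : A →L[ℂ] A) : Prop :=
  partialTraceLeft (pureState ψ : HilbertTensor C A →L[ℂ] HilbertTensor C A) = ρ

/-- The product states `σ ⊗ τ` on `C ⊗ A`. -/
def productStates (C : Type u) (A : Type v)
    [NormedAddCommGroup C] [InnerProductSpace ℂ C] [CompleteSpace C]
    [NormedAddCommGroup A] [InnerProductSpace ℂ A] [CompleteSpace A] :
    Set (HilbertTensor C A →L[ℂ] HilbertTensor C A) :=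
  {ω | ∃ (σ : C →L[ℂ] C) (τ : A →L[ℂ] A), IsState σ ∧ IsState τ ∧ ω = opTensor σ τ}

/-- Separable states on `C ⊗ A`: the states in the closed convex hull of the product states.
The closure may be taken in the operator norm, because on the set of states the operator norm
and the trace norm define the same topology. In particular, every finite or countable mixture
`∑ᵢ pᵢ σᵢ ⊗ τᵢ` is separable, and in finite dimension the separable states are
exactly the finite mixtures of this form. -/
def IsSeparable (ω : HilbertTensor C A →L[ℂ] HilbertTensor C A) : Prop :=
  IsState ω ∧ ω ∈ closure (convexHull ℝ (productStates C A))

end Tensor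

/-- A quantum channel: a completely positive trace preserving linear map between the trace class
operators. -/
structure QuantumChannel (A : Type u) (B : Type v)
    [NormedAddCommGroup A] [InnerProductSpace ℂ A] [CompleteSpace A]
    [NormedAddCommGroup B] [InnerProductSpace ℂ B] [CompleteSpace B]
    extends traceClass A →ₗ[ℂ] traceClass B where
  /-- Complete positivity: if the block operator `(T i j)` is positive on `Aⁿ`, then so is
  `(Ξ (T i j))` on `Bⁿ`. -/
  completelyPositive : ∀ (n : ℕ) (T : Fin n → Fin n → traceClass A),
    (∀ x : Fin n → A, 0 ≤ ∑ i, ∑ j, inner ℂ (x i) ((T i j : A →L[ℂ] A) (x j))) →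
    ∀ y : Fin n → B, 0 ≤ ∑ i, ∑ j, inner ℂ (y i) ((toFun (T i j) : B →L[ℂ] B) (y j))
  /-- Preservation of the trace of positive operators, hence by linearity of all traces. -/
  tracePreserving : ∀ T : traceClass A, (T : A →L[ℂ] A).IsPositive →
    posTrace (toFun T : B →L[ℂ] B) = posTrace (T : A →L[ℂ] A)

namespace QuantumChannel

variable {A : Type u} {B : Type v} {C : Type w}
  [NormedAddCommGroup A] [InnerProductSpace ℂ A] [CompleteSpace A]
  [NormedAddCommGroup B] [InnerProductSpace ℂ B] [CompleteSpace B]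
  [NormedAddCommGroup C] [InnerProductSpace ℂ C] [CompleteSpace C]

/-- The operator `Ξ(T)` for a trace class operator `T`. -/
def apply (Ξ : QuantumChannel A B) (T : traceClass A) : B →L[ℂ] B := Ξ.toLinearMap T

/-- The channel `1_C ⊗ Ξ`: with `X = ∑ᵢⱼ |eᵢ⟩⟨eⱼ| ⊗ Xᵢⱼ` where `Xᵢⱼ = (⟨eᵢ| ⊗ 1) X (|eⱼ⟩ ⊗ 1)`,
one has `(1 ⊗ Ξ)(X) = ∑ᵢⱼ |eᵢ⟩⟨eⱼ| ⊗ Ξ(Xᵢⱼ) = ∑ᵢⱼ (|eᵢ⟩ ⊗ 1) Ξ(Xᵢⱼ) (⟨eⱼ| ⊗ 1)`. By complete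
positivity, the family is summable in operator norm. -/
def idTensor (Ξ : QuantumChannel A B) (X : traceClass (HilbertTensor C A)) :
    HilbertTensor C B →L[ℂ] HilbertTensor C B :=
  ∑' p : basisIndex C × basisIndex C,
    ketTensor (basis C p.1) ∘L
      Ξ.apply ⟨(ketTensor (basis C p.1)).adjoint ∘L
          (X : HilbertTensor C A →L[ℂ] HilbertTensor C A) ∘L ketTensor (basis C p.2),
        conj_mem_traceClass X.2 _ _⟩ ∘L
      (ketTensor (basis C p.2)).adjoint

/-- The coherent information `I_c(ρ_A, Ξ) = S(ρ_B) - S(ρ_CB)`, where `ρ_B = Ξ(ρ_A)` and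
`ρ_CB = (1_C ⊗ Ξ)(|ψ⟩⟨ψ|)` for a purification `ψ ∈ C ⊗ A` of `ρ_A`. The entropies lie in `[0, ∞]`
and the difference in `[-∞, ∞]`. With the convention `∞ - ∞ = -∞` of `EReal`, the
inequality `S(ρ_B) - S(ρ_CB) ≤ 0` holds if and only if `S(ρ_B) ≤ S(ρ_CB)`. -/
def coherentInformation (Ξ : QuantumChannel A B) (ρA : traceClass A) (ψ : HilbertTensor C A) :
    EReal :=
  (vonNeumannEntropy (Ξ.apply ρA) : EReal) - (vonNeumannEntropy (Ξ.idTensor (pureState ψ)) : EReal)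

end QuantumChannel

end QInfo

end

/-! Write ω for ρ_CB. A separable state obeys the reduction inequality ω ≤ 1 ⊗ Tr_C ω. For a product
state this is σ ⊗ τ ≤ 1 ⊗ τ, true because σ ≤ 1 (`reductionBound_opTensor`). Both sides are affine
in ω, and the inequality survives limits of states because no mass is lost in the partial trace
(`IsSeparable.reductionBound`).

With ρ = Tr_C ω, operator monotonicity of the logarithm suggests S(ω) = -Tr ω log ω ≥ -Tr ω log (1 ⊗
ρ) = S(ρ). To avoid unbounded logarithms, ρ is shifted by ε > 0 and one eigenvector f of ω, with
eigenvalue l, is treated at a time: the reduction inequality gives ⟪f, (1 ⊗ (ρ + ε))⁻¹ f⟫ ≤ (l +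
ε)⁻¹ (`sum_div_le_of_reductionBound`), and Jensen's inequality for log turns this into a bound on
surprisals (`tsum_surprisal_le_of_reductionBound`). Averaging over the eigenvectors with weights l
and letting ε → 0 compares the entropies.

It remains that Tr_C ρ_CB = Ξ(ρ_A). As Tr_C is an infinite sum, this needs normality of Ξ, which
follows from positivity and trace preservation (`QuantumChannel.quad_apply_eq_tsum`). -/

noncomputable section

namespace QInfo

open Filter Topology Module.End

universe u v w

/-! ### Traces, Hilbert–Schmidt sums and compactness -/

section Trace

variable {H : Type u} [NormedAddCommGroup H] [InnerProductSpace ℂ H]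

/-- The quadratic form `⟪x, T x⟫` of an operator, truncated to `[0, ∞]`. -/
def quad (T : H →L[ℂ] H) (x : H) : ℝ≥0∞ := ENNReal.ofReal (inner ℂ x (T x)).re

lemma quad_smul (T : H →L[ℂ] H) (c : ℂ) (x : H) :
    quad T (c • x) = ENNReal.ofReal (‖c‖ ^ 2) * quad T x := by
  have h : inner ℂ (c • x) (T (c • x)) = ((‖c‖ ^ 2 : ℝ) : ℂ) * inner ℂ x (T x) := by
    rw [map_smul, inner_smul_left, inner_smul_right, ← mul_assoc, ← Complex.normSq_eq_conj_mul_self,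
      Complex.normSq_eq_norm_sq]
  rw [quad, quad, h, Complex.re_ofReal_mul, ENNReal.ofReal_mul (by positivity)]

lemma quad_add {S T : H →L[ℂ] H} (hS : S.IsPositive) (hT : T.IsPositive) (x : H) :
    quad (S + T) x = quad S x + quad T x := by
  rw [quad, quad, quad, add_apply, inner_add_right, Complex.add_re]
  exact ENNReal.ofReal_add (hS.re_inner_nonneg_right x) (hT.re_inner_nonneg_right x)

lemma quad_real_smul (T : H →L[ℂ] H) {r : ℝ} (hr : 0 ≤ r) (x : H) :
    quad (r • T) x = ENNReal.ofReal r * quad T x := by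
  rw [quad, quad, smul_apply, ← Complex.coe_smul, inner_smul_right, Complex.re_ofReal_mul,
    ENNReal.ofReal_mul hr]

variable [CompleteSpace H]

/-- Factoring T = S†S turns traces into Hilbert–Schmidt sums of S. -/
lemma exists_quad_eq_norm_sq {T : H →L[ℂ] H} (hT : T.IsPositive) :
    ∃ S : H →L[ℂ] H, T = S.adjoint ∘L S ∧ ∀ x, quad T x = ENNReal.ofReal (‖S x‖ ^ 2) := by
  obtain ⟨S, rfl⟩ := CStarAlgebra.nonneg_iff_eq_star_mul_self.mp
    ((ContinuousLinearMap.nonneg_iff_isPositive T).mpr hT)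
  refine ⟨S, rfl, fun x => ?_⟩
  rw [quad, ContinuousLinearMap.star_eq_adjoint, mul_apply_eq_comp,
    ContinuousLinearMap.adjoint_inner_right]
  exact congrArg _ (norm_sq_eq_re_inner (𝕜 := ℂ) (S x)).symm

/-- The trace of a positive operator may be computed in any Hilbert basis. -/
lemma posTrace_eq_tsum_quad {T : H →L[ℂ] H} (hT : T.IsPositive) {ι : Type*}
    (b : HilbertBasis ι ℂ H) : posTrace T = ∑' i, quad T (b i) := by
  obtain ⟨S, -, hS⟩ := exists_quad_eq_norm_sq hT
  change ∑' i, quad T (basis H i) = _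
  simp_rw [hS]
  -- Both Hilbert–Schmidt sums equal that of the adjoint in one fixed basis.
  rw [tsum_norm_sq_adjoint (basis H) (basis H), tsum_norm_sq_adjoint b (basis H)]

/-- The Hilbert–Schmidt norm dominates the operator norm: expand `S x` in a basis of `K` and apply
Cauchy–Schwarz to each coordinate ⟪S† c_k, x⟫. -/
lemma norm_sq_apply_le_tsum {K : Type v} [NormedAddCommGroup K] [InnerProductSpace ℂ K]
    [CompleteSpace K] {ι : Type*} (b : HilbertBasis ι ℂ H) (S : H →L[ℂ] K) (x : H) :
    ENNReal.ofReal (‖S x‖ ^ 2) ≤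
      ENNReal.ofReal (‖x‖ ^ 2) * ∑' i, ENNReal.ofReal (‖S (b i)‖ ^ 2) := by
  rw [tsum_norm_sq_adjoint b (basis K), ofReal_norm_sq_eq_tsum (basis K) (S x),
    ← ENNReal.tsum_mul_left]
  refine ENNReal.tsum_le_tsum fun k => ?_
  rw [← ENNReal.ofReal_mul (by positivity), ← mul_pow, ← ContinuousLinearMap.adjoint_inner_left,
    mul_comm]
  exact ENNReal.ofReal_le_ofReal (pow_le_pow_left₀ (norm_nonneg _) (norm_inner_le_norm _ _) 2)

lemma quad_le_posTrace {T : H →L[ℂ] H} (hT : T.IsPositive) (x : H) :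
    quad T x ≤ ENNReal.ofReal (‖x‖ ^ 2) * posTrace T := by
  obtain ⟨S, -, hS⟩ := exists_quad_eq_norm_sq hT
  rw [posTrace_eq_tsum_quad hT (basis H)]
  simp_rw [hS]
  exact norm_sq_apply_le_tsum (basis H) S x

/-- Hilbert–Schmidt operators are compact. -/
lemma isCompactOperator_of_tsum_lt_top {ι : Type*} (b : HilbertBasis ι ℂ H) (S : H →L[ℂ] H)
    (h : ∑' i, ENNReal.ofReal (‖S (b i)‖ ^ 2) < ∞) : IsCompactOperator S := by
  classical
  let P : Finset ι → H →L[ℂ] H := fun F => ∑ i ∈ F, InnerProductSpace.rankOne ℂ (b i) (b i)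
  have hP : ∀ F i, P F (b i) = if i ∈ F then b i else 0 := by
    intro F i
    simp only [P, sum_apply, InnerProductSpace.rankOne_apply,
      orthonormal_iff_ite.mp b.orthonormal, ite_smul, one_smul, zero_smul, Finset.sum_ite_eq']
  -- The finite rank operators S P_F converge to S in norm: the Hilbert–Schmidt sum of the
  -- difference is the tail of a convergent series.
  refine isCompactOperator_of_tendsto (l := atTop) (F := fun F => S ∘L P F) ?_ ?_
  · have hbound : ∀ F : Finset ι, ENNReal.ofReal (‖S ∘L P F - S‖ ^ 2) ≤
        ∑' i : {i // i ∉ F}, ENNReal.ofReal (‖S (b i)‖ ^ 2) := by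
      intro F
      set r := ∑' i : {i // i ∉ F}, ENNReal.ofReal (‖S (b i)‖ ^ 2) with hr
      have hrtop : r ≠ ∞ := ((ENNReal.tsum_comp_le_tsum_of_injective
        Subtype.val_injective _).trans_lt h).ne
      have e : ∑' i, ENNReal.ofReal (‖(S ∘L P F - S) (b i)‖ ^ 2) = r := by
        rw [hr]
        refine Eq.trans ?_ (tsum_subtype {i | i ∉ F}
          (fun i => ENNReal.ofReal (‖S (b i)‖ ^ 2))).symm
        refine tsum_congr fun i => ?_
        by_cases hi : i ∈ F <;> simp [hP, hi, Set.indicator]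
      have hop : ‖S ∘L P F - S‖ ≤ √r.toReal := by
        refine ContinuousLinearMap.opNorm_le_bound _ (Real.sqrt_nonneg _) fun x => ?_
        have hx := norm_sq_apply_le_tsum b (S ∘L P F - S) x
        rw [e, ← ENNReal.ofReal_toReal hrtop, ← ENNReal.ofReal_mul (by positivity),
          ENNReal.ofReal_le_ofReal_iff (by positivity)] at hx
        refine le_of_sq_le_sq ?_ (by positivity)
        rw [mul_pow, Real.sq_sqrt ENNReal.toReal_nonneg]
        linarith
      rw [← ENNReal.ofReal_toReal hrtop]
      refine ENNReal.ofReal_le_ofReal ?_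
      rw [← Real.sq_sqrt (ENNReal.toReal_nonneg (a := r))]
      exact pow_le_pow_left₀ (norm_nonneg _) hop 2
    have h0 : Tendsto (fun F => ENNReal.ofReal (‖S ∘L P F - S‖ ^ 2)) atTop (𝓝 0) :=
      tendsto_of_tendsto_of_tendsto_of_le_of_le tendsto_const_nhds
        (ENNReal.tendsto_tsum_compl_atTop_zero h.ne) (fun _ => zero_le) hbound
    have h1 := (ENNReal.tendsto_toReal ENNReal.zero_ne_top).comp h0
    have h2 := (Real.continuous_sqrt.tendsto _).comp h1
    rw [tendsto_iff_norm_sub_tendsto_zero]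
    refine Tendsto.congr (fun F => ?_) (by simpa using h2)
    simp [Real.sqrt_sq]
  · refine Eventually.of_forall fun F => ?_
    refine IsCompactOperator.clm_comp ?_ S
    have : P F ∈ compactOperator (RingHom.id ℂ) H H := by
      refine Submodule.sum_mem _ fun i _ => ?_
      have e : (InnerProductSpace.rankOne ℂ (b i) (b i) : H →L[ℂ] H) =
          ContinuousLinearMap.toSpanSingleton ℂ (b i) ∘L innerSL ℂ (b i) := by
        ext x; simp
      change IsCompactOperator (InnerProductSpace.rankOne ℂ (b i) (b i) : H →L[ℂ] H)
      rw [e]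
      have hc : IsCompactOperator (ContinuousLinearMap.toSpanSingleton ℂ (b i)) :=
        isCompactOperator_of_locallyCompactSpace_rng _
      exact hc.comp_clm _
    exact this

lemma isCompactOperator_of_posTrace_lt_top {T : H →L[ℂ] H} (hT : T.IsPositive)
    (h : posTrace T < ∞) : IsCompactOperator T := by
  obtain ⟨S, rfl, hS⟩ := exists_quad_eq_norm_sq hT
  rw [posTrace_eq_tsum_quad hT (basis H)] at h
  simp_rw [hS] at h
  exact (isCompactOperator_of_tsum_lt_top (basis H) S h).clm_comp S.adjoint

/-! ### Eigenbases, functional calculus and the entropy of a state -/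

lemma clm_ext_hilbertBasis {E : Type v} [NormedAddCommGroup E] [InnerProductSpace ℂ E]
    {K : Type w} [NormedAddCommGroup K] [NormedSpace ℂ K] {ι : Type*}
    (b : HilbertBasis ι ℂ E) {S T : E →L[ℂ] K} (h : ∀ i, S (b i) = T (b i)) : S = T :=
  ContinuousLinearMap.ext_on (s := Set.range b)
    (Submodule.dense_iff_topologicalClosure_eq_top.mpr b.dense_span)
    (by rintro _ ⟨i, rfl⟩; exact h i)

/-- A compact self-adjoint operator has a Hilbert basis of eigenvectors. -/
lemma exists_hilbertBasis_eigenvectors {T : H →L[ℂ] H} (hT : IsCompactOperator T)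
    (hT' : T.IsSymmetric) :
    ∃ (ι : Type u) (b : HilbertBasis ι ℂ H) (l : ι → ℂ), ∀ i, T (b i) = l i • b i := by
  have hcl : ∀ μ : ℂ, IsClosed (eigenspace (T : Module.End ℂ H) μ : Set H) := fun μ => by
    have : (eigenspace (T : Module.End ℂ H) μ : Set H) = {x | T x = μ • x} := by
      ext x; simp
    rw [this]
    exact isClosed_eq T.continuous (continuous_const_smul μ)
  have : ∀ μ : ℂ, CompleteSpace (eigenspace (T : Module.End ℂ H) μ) :=
    fun μ => (hcl μ).completeSpace_coe
  choose w c hc using fun μ : ℂ =>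
    exists_hilbertBasis ℂ (eigenspace (T : Module.End ℂ H) μ)
  have horth := (LinearMap.IsSymmetric.orthogonalFamily_eigenspaces
    hT').orthonormal_sigma_orthonormal (fun μ => (c μ).orthonormal)
  refine ⟨Σ μ : ℂ, w μ, HilbertBasis.mkOfOrthogonalEqBot horth ?_, fun i => i.1, fun i => ?_⟩
  · rw [eq_bot_iff, ← ContinuousLinearMap.orthogonalComplement_iSup_eigenspaces_eq_bot hT hT']
    intro x hx
    rw [← Submodule.iInf_orthogonal, Submodule.mem_iInf]
    intro μ
    rw [Submodule.mem_orthogonal']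
    intro v hv
    -- A vector orthogonal to a Hilbert basis of an eigenspace is orthogonal to all of it, by
    -- continuity.
    have hz : innerSL ℂ x ∘L (eigenspace (T : Module.End ℂ H) μ).subtypeL = 0 :=
      clm_ext_hilbertBasis (c μ) fun i => by
        rw [hc μ]
        exact (Submodule.mem_orthogonal' _ _).mp hx _
          (Submodule.subset_span ⟨⟨μ, i⟩, by simp [hc μ]⟩)
    exact DFunLike.congr_fun hz ⟨v, hv⟩
  · rw [HilbertBasis.coe_mkOfOrthogonalEqBot]
    exact mem_eigenspace_iff.mp (c i.1 i.2).2

/-- The identity holds for constants and for the coordinate function, is stable under sums and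
products, and is closed under uniform limits, so Stone–Weierstrass gives all continuous functions on
the spectrum. -/
lemma cfc_apply_eigenvector {T : H →L[ℂ] H} (hT : IsSelfAdjoint T) {f : H} {l : ℝ}
    (hf : T f = (l : ℂ) • f) (hf0 : f ≠ 0) {g : ℝ → ℝ} (hg : Continuous g) :
    cfc g T f = (g l : ℂ) • f := by
  have hl : l ∈ spectrum ℝ T := by
    rw [spectrum.mem_iff]
    intro hu
    obtain ⟨u, hu⟩ := hu
    refine hf0 ?_
    have h1 : (algebraMap ℝ (H →L[ℂ] H) l - T) f = 0 := by
      simp [hf, Algebra.algebraMap_eq_smul_one]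
    rw [← hu] at h1
    have h2 : ((↑u⁻¹ * ↑u : H →L[ℂ] H)) f = 0 := by
      rw [mul_apply_eq_comp, h1, map_zero]
    simpa using h2
  have key : ∀ φ : C(spectrum ℝ T, ℝ), cfcHom hT φ f = (φ ⟨l, hl⟩ : ℂ) • f := by
    intro φ
    induction φ using ContinuousMap.induction_on_of_compact with
    | const r =>
      have : ContinuousMap.const (spectrum ℝ T) r = algebraMap ℝ _ r := rfl
      rw [this, AlgHomClass.commutes]
      simp [Algebra.algebraMap_eq_smul_one]
    | id => rw [cfcHom_id]; simpa using hf
    | star_id => rw [map_star, cfcHom_id, hT.star_eq]; simpa using hf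
    | add φ χ hφ hχ => simp [map_add, hφ, hχ, add_smul]
    | mul φ χ hφ hχ => 
      rw [map_mul, mul_apply_eq_comp, hχ, map_smul, hφ, smul_smul, ContinuousMap.mul_apply,
        Complex.ofReal_mul, mul_comm]
    | frequently φ hφ =>
      have hclosed : IsClosed {φ : C(spectrum ℝ T, ℝ) | cfcHom hT φ f = (φ ⟨l, hl⟩ : ℂ) • f} := by
        refine isClosed_eq ?_ ?_
        · exact (ContinuousLinearMap.apply ℂ H f).continuous.comp (cfcHom_continuous hT)
        · exact (Complex.continuous_ofReal.comp (ContinuousEvalConst.continuous_eval_const _)).smul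
            continuous_const
      exact hclosed.mem_of_frequently_of_tendsto hφ tendsto_id
  rw [cfc_apply g T hT hg.continuousOn, key]
  rfl

lemma IsState.le_one {ρ : H →L[ℂ] H} (h : IsState ρ) : ρ ≤ 1 := by
  refine ⟨((IsSelfAdjoint.one _).sub h.1.isSelfAdjoint).isSymmetric, fun x => ?_⟩
  have h1 := quad_le_posTrace h.1 x
  rw [h.2, mul_one, quad, ENNReal.ofReal_le_ofReal_iff (by positivity),
    norm_sq_eq_re_inner (𝕜 := ℂ)] at h1
  have h2 : (inner ℂ ((1 - ρ) x) x : ℂ) = inner ℂ x x - inner ℂ (ρ x) x := by simp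
  have h3 : (inner ℂ x (ρ x) : ℂ).re = (inner ℂ (ρ x) x : ℂ).re := inner_re_symm (𝕜 := ℂ) _ _
  rw [ContinuousLinearMap.reApplyInnerSelf_apply, h2]
  simpa [h3] using h1

/-- A state is diagonal in some Hilbert basis, and its entropy is the Shannon entropy of its
eigenvalues. -/
lemma IsState.exists_eigenbasis {ρ : H →L[ℂ] H} (h : IsState ρ) :
    ∃ (ι : Type u) (b : HilbertBasis ι ℂ H) (l : ι → ℝ), (∀ i, ρ (b i) = (l i : ℂ) • b i) ∧
      (∀ i, 0 ≤ l i) ∧ (∀ i, l i ≤ 1) ∧ ∑' i, ENNReal.ofReal (l i) = 1 ∧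
      vonNeumannEntropy ρ = ∑' i, ENNReal.ofReal (Real.negMulLog (l i) / Real.log 2) := by
  obtain ⟨ι, b, l, hl⟩ := exists_hilbertBasis_eigenvectors
    (isCompactOperator_of_posTrace_lt_top h.1 (by rw [h.2]; exact ENNReal.one_lt_top))
    h.1.isSymmetric
  have hn : ∀ i, ‖b i‖ = 1 := fun i => b.orthonormal.1 i
  have hb0 : ∀ i, b i ≠ 0 := fun i => b.orthonormal.ne_zero i
  have hin : ∀ (i) (z : ℂ), inner ℂ (b i) (z • b i) = z := fun i z => by
    rw [inner_smul_right, inner_self_eq_norm_sq_to_K, hn]; simp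
  have hreal : ∀ i, l i = ((l i).re : ℂ) := fun i => by
    have := h.1.inner_nonneg_right (b i)
    rw [hl, hin] at this
    exact Complex.eq_re_of_ofReal_le (r := 0) (by simpa using this)
  have hquad : ∀ i, quad ρ (b i) = ENNReal.ofReal (l i).re := fun i => by
    rw [quad, hl, hin]
  have hsum : ∑' i, ENNReal.ofReal (l i).re = 1 := by
    rw [← h.2, posTrace_eq_tsum_quad h.1 b]
    simp_rw [hquad]
  have hl' : ∀ i, ρ (b i) = ((l i).re : ℂ) • b i := fun i => by rw [← hreal, hl]
  refine ⟨ι, b, fun i => (l i).re, hl', fun i => ?_, fun i => ?_, hsum, ?_⟩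
  · have := h.1.re_inner_nonneg_right (b i)
    rw [hl, hin] at this
    exact this
  · rw [← ENNReal.ofReal_le_one, ← hsum]
    exact ENNReal.le_tsum i
  · have hg : Continuous fun x : ℝ => Real.negMulLog x / Real.log 2 :=
      Real.continuous_negMulLog.div_const _
    -- Positivity is what permits computing the trace in the eigenbasis; it holds because the
    -- spectrum lies in [0, 1].
    have hpos : (cfc (fun x : ℝ => Real.negMulLog x / Real.log 2) ρ).IsPositive := by
      rw [← ContinuousLinearMap.nonneg_iff_isPositive]
      refine cfc_nonneg fun x hx => div_nonneg (Real.negMulLog_nonneg ?_ ?_)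
        (Real.log_nonneg one_le_two)
      · exact spectrum_nonneg_of_nonneg
          ((ContinuousLinearMap.nonneg_iff_isPositive ρ).mpr h.1) hx
      · exact (le_algebraMap_iff_spectrum_le (R := ℝ) (r := 1) h.1.isSelfAdjoint).mp
          (by simpa using h.le_one) x hx
    rw [vonNeumannEntropy, posTrace_eq_tsum_quad hpos b]
    refine tsum_congr fun i => ?_
    rw [quad, cfc_apply_eigenvector h.1.isSelfAdjoint (hl' i) (hb0 i) hg, hin, Complex.ofReal_re]

end Trace

/-! ### Sums of positive operators -/

section Sums

variable {H : Type u} [NormedAddCommGroup H] [InnerProductSpace ℂ H] {ι : Type*}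

lemma quad_zero (x : H) : quad 0 x = 0 := by simp [quad]

lemma quad_sum (s : Finset ι) {X : ι → H →L[ℂ] H} (hX : ∀ i ∈ s, (X i).IsPositive) (x : H) :
    quad (∑ i ∈ s, X i) x = ∑ i ∈ s, quad (X i) x := by
  classical
  induction s using Finset.induction_on with
  | empty => simp [quad_zero]
  | insert a s ha ih =>
    rw [Finset.sum_insert ha, Finset.sum_insert ha, quad_add (hX a (by simp))
      (ContinuousLinearMap.isPositive_sum s fun i hi => hX i (by simp [hi])),
      ih fun i hi => hX i (by simp [hi])]

lemma hasSum_re_inner {X : ι → H →L[ℂ] H} {T : H →L[ℂ] H} (h : HasSum X T) (x : H) :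
    HasSum (fun i => (inner ℂ x (X i x)).re) (inner ℂ x (T x)).re :=
  Complex.hasSum_re ((innerSL ℂ x).hasSum ((ContinuousLinearMap.apply ℂ _ x).hasSum h))

lemma quad_eq_tsum {X : ι → H →L[ℂ] H} {T : H →L[ℂ] H} (hX : ∀ i, (X i).IsPositive)
    (h : HasSum X T) (x : H) : quad T x = ∑' i, quad (X i) x := by
  have hs := hasSum_re_inner h x
  rw [quad, ← hs.tsum_eq]
  exact ENNReal.ofReal_tsum_of_nonneg (fun i => (hX i).re_inner_nonneg_right x) hs.summable

variable [CompleteSpace H]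

lemma sum_le_of_hasSum_isPositive {X : ι → H →L[ℂ] H} {T : H →L[ℂ] H}
    (hX : ∀ i, (X i).IsPositive) (h : HasSum X T) (s : Finset ι) : ∑ i ∈ s, X i ≤ T := by
  classical
  rw [← sub_nonneg]
  refine CStarAlgebra.isClosed_nonneg.mem_of_tendsto (Tendsto.sub_const h (∑ i ∈ s, X i)) ?_
  filter_upwards [eventually_ge_atTop s] with F hF
  change 0 ≤ ∑ i ∈ F, X i - ∑ i ∈ s, X i
  rw [← Finset.sum_sdiff_eq_sub hF, ContinuousLinearMap.nonneg_iff_isPositive]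
  exact ContinuousLinearMap.isPositive_sum _ fun i _ => hX i

lemma posTrace_add {S T : H →L[ℂ] H} (hS : S.IsPositive) (hT : T.IsPositive) :
    posTrace (S + T) = posTrace S + posTrace T := by
  simp only [posTrace_eq_tsum_quad (hS.add hT) (basis H), posTrace_eq_tsum_quad hS (basis H),
    posTrace_eq_tsum_quad hT (basis H), quad_add hS hT, ENNReal.tsum_add]

lemma posTrace_sum (s : Finset ι) {X : ι → H →L[ℂ] H} (hX : ∀ i ∈ s, (X i).IsPositive) :
    posTrace (∑ i ∈ s, X i) = ∑ i ∈ s, posTrace (X i) := by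
  rw [posTrace_eq_tsum_quad (ContinuousLinearMap.isPositive_sum s hX) (basis H)]
  simp only [quad_sum s hX]
  rw [Summable.tsum_finsetSum fun _ _ => ENNReal.summable]
  exact Finset.sum_congr rfl fun i hi => (posTrace_eq_tsum_quad (hX i hi) _).symm

end Sums

/-! ### Product bases and the partial trace -/

section Tensor

variable {C : Type u} {A : Type v}
  [NormedAddCommGroup C] [InnerProductSpace ℂ C] [NormedAddCommGroup A] [InnerProductSpace ℂ A]

lemma ketTensor_apply (c : C) (a : A) :
    ketTensor c a = ((c ⊗ₜ[ℂ] a : C ⊗[ℂ] A) : HilbertTensor C A) := rfl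

lemma inner_ketTensor (c c' : C) (a a' : A) :
    inner ℂ (ketTensor c a) (ketTensor c' a') = inner ℂ c c' * inner ℂ a a' := by
  rw [ketTensor_apply, ketTensor_apply, UniformSpace.Completion.inner_coe,
    TensorProduct.inner_tmul]

/-- The operator `c ↦ c ⊗ a`. -/
def ketTensorRight (a : A) : C →L[ℂ] HilbertTensor C A :=
  UniformSpace.Completion.toComplL ∘L (TensorProduct.mkL ℂ C A).flip a

variable [CompleteSpace C] [CompleteSpace A]

omit [CompleteSpace C] in
lemma adjoint_ketTensor_ketTensor (c c' : C) (a : A) :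
    (ketTensor c).adjoint (ketTensor c' a) = inner ℂ c c' • a := by
  refine ext_inner_left ℂ fun x => ?_
  rw [ContinuousLinearMap.adjoint_inner_right, inner_ketTensor, inner_smul_right]

omit [CompleteSpace C] [CompleteSpace A] in
lemma orthonormal_ketTensor {ι κ : Type*} {e : ι → C} {b : κ → A} (he : Orthonormal ℂ e)
    (hb : Orthonormal ℂ b) : Orthonormal ℂ fun p : ι × κ => ketTensor (e p.1) (b p.2) := by
  classical
  rw [orthonormal_iff_ite] at *
  rintro ⟨i, j⟩ ⟨i', j'⟩
  rw [inner_ketTensor, he, hb]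
  by_cases h : i = i' <;> by_cases h' : j = j' <;> simp [h, h']

/-- The product Hilbert basis `e i ⊗ b j`. -/
def tensorBasis {ι κ : Type*} (e : HilbertBasis ι ℂ C) (b : HilbertBasis κ ℂ A) :
    HilbertBasis (ι × κ) ℂ (HilbertTensor C A) :=
  HilbertBasis.mkOfOrthogonalEqBot (orthonormal_ketTensor e.orthonormal b.orthonormal) <| by
    refine (Submodule.eq_bot_iff _).mpr fun v hv => ?_
    rw [Submodule.mem_orthogonal'] at hv
    -- Orthogonality to the products e_i ⊗ b_j extends to e_i ⊗ y, to c ⊗ y, to the algebraic tensor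
    -- product and to its completion.
    have h1 : ∀ i y, inner ℂ v (ketTensor (e i) y) = 0 := fun i y => by
      have : innerSL ℂ v ∘L ketTensor (e i) = 0 := clm_ext_hilbertBasis b fun j =>
        hv _ (Submodule.subset_span ⟨(i, j), rfl⟩)
      exact DFunLike.congr_fun this y
    have h2 : ∀ c y, inner ℂ v (ketTensor c y) = 0 := fun c y => by
      have : innerSL ℂ v ∘L ketTensorRight y = 0 := clm_ext_hilbertBasis e fun i => h1 i y
      exact DFunLike.congr_fun this c
    have h3 : ∀ t : C ⊗[ℂ] A, inner ℂ v (t : HilbertTensor C A) = 0 := fun t => by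
      induction t with
      | zero => rw [UniformSpace.Completion.coe_zero, inner_zero_right]
      | tmul c y => exact h2 c y
      | add s t hs ht => rw [UniformSpace.Completion.coe_add, inner_add_right, hs, ht, add_zero]
    have h4 : ∀ x : HilbertTensor C A, inner ℂ v x = 0 := fun x => by
      induction x using UniformSpace.Completion.induction_on with
      | hp => exact isClosed_eq (innerSL ℂ v).continuous continuous_const
      | ih t => exact h3 t
    exact inner_self_eq_zero.mp (h4 v)

omit [CompleteSpace C] [CompleteSpace A] in
lemma tensorBasis_apply {ι κ : Type*} (e : HilbertBasis ι ℂ C) (b : HilbertBasis κ ℂ A)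
    (p : ι × κ) : tensorBasis e b p = ketTensor (e p.1) (b p.2) := by
  rw [tensorBasis, HilbertBasis.coe_mkOfOrthogonalEqBot]

/-- The quadratic form of the partial trace `Tr_C ω`, as an element of `[0, ∞]`. -/
def marginalQuad {ι : Type*} (e : HilbertBasis ι ℂ C) (ω : HilbertTensor C A →L[ℂ] HilbertTensor C A)
    (y : A) : ℝ≥0∞ :=
  ∑' i, quad ω (ketTensor (e i) y)

omit [CompleteSpace C] [CompleteSpace A] in
lemma posTrace_eq_tsum_marginalQuad {ι κ : Type*} (e : HilbertBasis ι ℂ C)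
    (b : HilbertBasis κ ℂ A) {ω : HilbertTensor C A →L[ℂ] HilbertTensor C A} (hω : ω.IsPositive) :
    posTrace ω = ∑' j, marginalQuad e ω (b j) := by
  rw [posTrace_eq_tsum_quad hω (tensorBasis e b), ENNReal.tsum_prod', ENNReal.tsum_comm]
  simp_rw [tensorBasis_apply]
  rfl

end Tensor

/-! ### Normality of channels and the marginal of the output -/

namespace QuantumChannel

variable {A : Type u} {B : Type v} {C : Type w}
  [NormedAddCommGroup A] [InnerProductSpace ℂ A] [CompleteSpace A]
  [NormedAddCommGroup B] [InnerProductSpace ℂ B] [CompleteSpace B]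
  [NormedAddCommGroup C] [InnerProductSpace ℂ C] [CompleteSpace C]

/-- Complete positivity at n = 1; the order on ℂ also forces the quadratic form to be real, which
gives symmetry. -/
lemma isPositive_apply (Ξ : QuantumChannel A B) {T : traceClass A}
    (hT : (T : A →L[ℂ] A).IsPositive) : (Ξ.apply T).IsPositive := by
  rw [ContinuousLinearMap.isPositive_iff_complex]
  intro y
  have h := Ξ.completelyPositive 1 (fun _ _ => T) (fun x => by
    simpa using hT.inner_nonneg_right (x 0)) (fun _ => y)
  simp only [Fin.sum_univ_one] at h
  replace h : 0 ≤ inner ℂ y (Ξ.apply T y) := h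
  obtain ⟨h1, h2⟩ := Complex.nonneg_iff.mp h
  have e : inner ℂ (Ξ.apply T y) y = ((inner ℂ y (Ξ.apply T y)).re : ℂ) := by
    refine (inner_conj_symm (𝕜 := ℂ) _ _).symm.trans (Complex.ext (Complex.conj_re _) ?_)
    rw [Complex.conj_im, ← h2, Complex.ofReal_im, neg_zero]
  rw [e]
  exact ⟨by simp, by simpa using h1⟩

lemma apply_add (Ξ : QuantumChannel A B) (S T : traceClass A) :
    Ξ.apply (S + T) = Ξ.apply S + Ξ.apply T := by simp [apply]

lemma apply_sum (Ξ : QuantumChannel A B) {ι : Type*} (s : Finset ι) (T : ι → traceClass A) :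
    Ξ.apply (∑ i ∈ s, T i) = ∑ i ∈ s, Ξ.apply (T i) := by simp [apply]

/-- Normality of quantum channels. -/
lemma quad_apply_eq_tsum (Ξ : QuantumChannel A B) {ι : Type*} {T : traceClass A}
    {X : ι → traceClass A} (hX : ∀ i, (X i : A →L[ℂ] A).IsPositive)
    (hT : posTrace (T : A →L[ℂ] A) < ∞)
    (h : HasSum (fun i => (X i : A →L[ℂ] A)) (T : A →L[ℂ] A)) (y : B) :
    quad (Ξ.apply T) y = ∑' i, quad (Ξ.apply (X i)) y := by
  have hsum : ∀ F : Finset ι, ((∑ i ∈ F, X i : traceClass A) : A →L[ℂ] A).IsPositive := fun F => by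
    rw [Submodule.coe_sum]
    exact ContinuousLinearMap.isPositive_sum F fun i _ => hX i
  have hq : ∀ x, quad (T : A →L[ℂ] A) x = ∑' i, quad (X i : A →L[ℂ] A) x := fun x =>
    quad_eq_tsum hX h x
  have hD : ∀ F : Finset ι, ((T - ∑ i ∈ F, X i : traceClass A) : A →L[ℂ] A).IsPositive := fun F => by
    rw [Submodule.coe_sub, Submodule.coe_sum, ← ContinuousLinearMap.le_def]
    exact sum_le_of_hasSum_isPositive hX h F
  have htr : posTrace (T : A →L[ℂ] A) = ∑' i, posTrace (X i : A →L[ℂ] A) := by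
    simp only [posTrace_eq_tsum_quad (hX _) (basis A)]
    rw [ENNReal.tsum_comm]
    exact tsum_congr fun k => hq _
  have hsplit : ∀ F : Finset ι, posTrace (T : A →L[ℂ] A) = ∑ i ∈ F, posTrace (X i : A →L[ℂ] A) +
      posTrace ((T - ∑ i ∈ F, X i : traceClass A) : A →L[ℂ] A) := fun F => by
    rw [← posTrace_sum F fun i _ => hX i, ← Submodule.coe_sum, ← posTrace_add (hsum F) (hD F),
      ← Submodule.coe_add, add_sub_cancel]
  have hsplit' : ∀ F : Finset ι, quad (Ξ.apply T) y = ∑ i ∈ F, quad (Ξ.apply (X i)) y +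
      quad (Ξ.apply (T - ∑ i ∈ F, X i)) y := fun F => by
    rw [← quad_sum F fun i _ => Ξ.isPositive_apply (hX i), ← apply_sum,
      ← quad_add (Ξ.isPositive_apply (hsum F)) (Ξ.isPositive_apply (hD F)), ← apply_add,
      add_sub_cancel]
  -- The remainders T - ∑ X_i are positive with trace tending to 0. Since Ξ preserves this trace,
  -- their images vanish in the limit as well.
  have h0 : Tendsto (fun F : Finset ι => posTrace ((T - ∑ i ∈ F, X i : traceClass A) : A →L[ℂ] A))
      atTop (𝓝 0) := by
    have h1 : Tendsto (fun F : Finset ι => posTrace (T : A →L[ℂ] A) -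
        ∑ i ∈ F, posTrace (X i : A →L[ℂ] A)) atTop (𝓝 (posTrace (T : A →L[ℂ] A) -
        ∑' i, posTrace (X i : A →L[ℂ] A))) :=
      ENNReal.Tendsto.sub tendsto_const_nhds ENNReal.summable.hasSum (Or.inl hT.ne)
    rw [← htr, tsub_self] at h1
    refine h1.congr fun F => ?_
    conv_lhs => rw [hsplit F]
    refine ENNReal.add_sub_cancel_left (ne_top_of_le_ne_top hT.ne ?_)
    rw [hsplit F]
    exact le_self_add
  have h1 : Tendsto (fun F : Finset ι => quad (Ξ.apply (T - ∑ i ∈ F, X i)) y) atTop (𝓝 0) := by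
    refine tendsto_of_tendsto_of_tendsto_of_le_of_le tendsto_const_nhds
      (h := fun F : Finset ι => ENNReal.ofReal (‖y‖ ^ 2) *
        posTrace ((T - ∑ i ∈ F, X i : traceClass A) : A →L[ℂ] A)) ?_ (fun _ => zero_le) fun F => ?_
    · simpa only [mul_zero] using
        ENNReal.Tendsto.const_mul h0 (Or.inr (ENNReal.ofReal_ne_top (r := ‖y‖ ^ 2)))
    · beta_reduce
      rw [← Ξ.tracePreserving _ (hD F)]
      exact quad_le_posTrace (Ξ.isPositive_apply (hD F)) y
  have h2 := Tendsto.add (ENNReal.summable (f := fun i => quad (Ξ.apply (X i)) y)).hasSum h1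
  rw [add_zero] at h2
  refine tendsto_nhds_unique tendsto_const_nhds (h2.congr fun F => ?_)
  exact (hsplit' F).symm

/-- The block `(⟨e| ⊗ 1) X (|e'⟩ ⊗ 1)` of a trace class operator. -/
def block (X : traceClass (HilbertTensor C A)) (c c' : C) : traceClass A :=
  ⟨(ketTensor c).adjoint ∘L (X : HilbertTensor C A →L[ℂ] HilbertTensor C A) ∘L ketTensor c',
    conj_mem_traceClass X.2 _ _⟩

/-- The sum defining `idTensor` takes the default value 0 unless it is summable, so the hypothesis
`h` supplies convergence; orthonormality then isolates one block. -/
lemma adjoint_ketTensor_idTensor (Ξ : QuantumChannel A B) {X : traceClass (HilbertTensor C A)}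
    (h : Ξ.idTensor X ≠ 0) (i j : basisIndex C) (y : B) :
    (ketTensor (basis C i)).adjoint (Ξ.idTensor X (ketTensor (basis C j) y)) =
      Ξ.apply (block X (basis C i) (basis C j)) y := by
  classical
  have hs : HasSum _ (Ξ.idTensor X) :=
    (not_imp_comm.mp tsum_eq_zero_of_not_summable h).hasSum
  have h1 := (((ketTensor (basis C i)).adjoint).hasSum
    ((ContinuousLinearMap.apply ℂ _ (ketTensor (basis C j) y)).hasSum hs))
  refine h1.unique ?_
  convert hasSum_ite_eq (i, j) (Ξ.apply (block X (basis C i) (basis C j)) y) using 1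
  funext p
  have ho := orthonormal_iff_ite.mp (basis C).orthonormal
  simp only [ContinuousLinearMap.apply_apply,
    ContinuousLinearMap.comp_apply, adjoint_ketTensor_ketTensor, ho]
  obtain ⟨i', j'⟩ := p
  by_cases hi : i = i' <;> by_cases hj : j' = j
  · subst hi hj; simp [block]
  all_goals simp [hi, hj, Prod.ext_iff, eq_comm (a := i')]

/-- The partial trace of `(1 ⊗ Ξ)(|ψ⟩⟨ψ|)` over the first factor is `Ξ(Tr_C |ψ⟩⟨ψ|)`. -/
lemma marginalQuad_idTensor (Ξ : QuantumChannel A B) {ρA : traceClass A}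
    (hρA : IsState (ρA : A →L[ℂ] A)) {ψ : HilbertTensor C A}
    (hψ : IsPurification ψ (ρA : A →L[ℂ] A)) (h : Ξ.idTensor (pureState ψ) ≠ 0) (y : B) :
    marginalQuad (basis C) (Ξ.idTensor (pureState ψ)) y = quad (Ξ.apply ρA) y := by
  have hs : HasSum (fun i => (block (pureState ψ) (basis C i) (basis C i) : A →L[ℂ] A)) ρA := by
    rw [← hψ]
    -- If the partial trace did not converge, its default value 0 would equal ρ_A, which has trace
    -- one.
    refine (not_imp_comm.mp tsum_eq_zero_of_not_summable fun h0 => ?_).hasSum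
    have h1 := hρA.2
    have h2 : (ρA : A →L[ℂ] A) = 0 := hψ.symm.trans h0
    simp [h2, posTrace] at h1
  rw [quad_apply_eq_tsum Ξ (fun i => ?_) (by rw [hρA.2]; exact ENNReal.one_lt_top) hs, marginalQuad]
  · refine tsum_congr fun i => ?_
    rw [quad, ← ContinuousLinearMap.adjoint_inner_right, adjoint_ketTensor_idTensor Ξ h, quad]
  · exact (InnerProductSpace.isPositive_rankOne_self ψ).adjoint_conj _

end QuantumChannel

/-! ### The reduction inequality for separable states -/

section Reduction

variable {C : Type u} {A : Type v}
  [NormedAddCommGroup C] [InnerProductSpace ℂ C] [CompleteSpace C]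
  [NormedAddCommGroup A] [InnerProductSpace ℂ A] [CompleteSpace A]

/-- The reduction bound `ω ≤ 1 ⊗ Tr_C ω`, tested on vectors of finite support in the first factor. -/
def ReductionBound {ι : Type*} (e : HilbertBasis ι ℂ C)
    (ω : HilbertTensor C A →L[ℂ] HilbertTensor C A) : Prop :=
  ∀ (F : Finset ι) (y : ι → A),
    quad ω (∑ i ∈ F, ketTensor (e i) (y i)) ≤ ∑ i ∈ F, marginalQuad e ω (y i)

omit [CompleteSpace C] [CompleteSpace A] in
lemma opTensor_ketTensor (σ : C →L[ℂ] C) (τ : A →L[ℂ] A) (c : C) (a : A) :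
    opTensor σ τ (ketTensor c a) = ketTensor (σ c) (τ a) := by
  rw [ketTensor_apply, opTensor, ContinuousLinearMap.completion_apply_coe,
    TensorProduct.mapL_tmul, ketTensor_apply]

omit [CompleteSpace C] [CompleteSpace A] in
lemma norm_opTensor_apply_le (σ : C →L[ℂ] C) (τ : A →L[ℂ] A) (x : HilbertTensor C A) :
    ‖opTensor σ τ x‖ ≤ ‖σ‖ * ‖τ‖ * ‖x‖ := by
  induction x using UniformSpace.Completion.induction_on with
  | hp => exact isClosed_le (opTensor σ τ).continuous.norm (continuous_norm.const_mul _)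
  | ih t =>
    rw [opTensor, ContinuousLinearMap.completion_apply_coe, UniformSpace.Completion.norm_coe,
      UniformSpace.Completion.norm_coe]
    exact (TensorProduct.mapL σ τ).le_of_opNorm_le (TensorProduct.norm_mapL_le σ τ) t

/-- S†S ⊗ T†T = (S ⊗ T)†(S ⊗ T), checked on matrix entries in a product basis. -/
lemma isPositive_opTensor {σ : C →L[ℂ] C} {τ : A →L[ℂ] A} (hσ : σ.IsPositive)
    (hτ : τ.IsPositive) : (opTensor σ τ).IsPositive := by
  obtain ⟨S, rfl, -⟩ := exists_quad_eq_norm_sq hσ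
  obtain ⟨T, rfl, -⟩ := exists_quad_eq_norm_sq hτ
  have e : opTensor (S.adjoint ∘L S) (T.adjoint ∘L T) =
      (opTensor S T).adjoint ∘L opTensor S T := by
    refine clm_ext_hilbertBasis (tensorBasis (basis C) (basis A)) fun p => ?_
    refine (tensorBasis (basis C) (basis A)).repr.injective (lp.ext (funext fun q => ?_))
    rw [HilbertBasis.repr_apply_apply, HilbertBasis.repr_apply_apply]
    simp only [tensorBasis_apply, ContinuousLinearMap.comp_apply,
      ContinuousLinearMap.adjoint_inner_right, opTensor_ketTensor, inner_ketTensor]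
  rw [e]
  exact ContinuousLinearMap.isPositive_adjoint_comp_self _

omit [CompleteSpace C] [CompleteSpace A] in
lemma quad_opTensor_ketTensor {σ : C →L[ℂ] C} {τ : A →L[ℂ] A} (hσ : σ.IsPositive)
    (hτ : τ.IsPositive) (c : C) (a : A) :
    quad (opTensor σ τ) (ketTensor c a) = quad σ c * quad τ a := by
  have h1 := Complex.nonneg_iff.mp (hσ.inner_nonneg_right c)
  have h2 := Complex.nonneg_iff.mp (hτ.inner_nonneg_right a)
  rw [quad, quad, quad, opTensor_ketTensor, inner_ketTensor, ← ENNReal.ofReal_mul h1.1,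
    Complex.mul_re, ← h1.2, zero_mul, sub_zero]

omit [CompleteSpace A] in
lemma marginalQuad_opTensor {ι : Type*} (e : HilbertBasis ι ℂ C) {σ : C →L[ℂ] C}
    {τ : A →L[ℂ] A} (hσ : IsState σ) (hτ : τ.IsPositive) (a : A) :
    marginalQuad e (opTensor σ τ) a = quad τ a := by
  simp_rw [marginalQuad, quad_opTensor_ketTensor hσ.1 hτ]
  rw [ENNReal.tsum_mul_right, ← posTrace_eq_tsum_quad hσ.1 e, hσ.2, one_mul]

lemma isState_opTensor {σ : C →L[ℂ] C} {τ : A →L[ℂ] A} (hσ : IsState σ) (hτ : IsState τ) :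
    IsState (opTensor σ τ) := by
  refine ⟨isPositive_opTensor hσ.1 hτ.1, ?_⟩
  rw [posTrace_eq_tsum_marginalQuad (basis C) (basis A) (isPositive_opTensor hσ.1 hτ.1), ← hτ.2,
    posTrace_eq_tsum_quad hτ.1 (basis A)]
  simp_rw [marginalQuad_opTensor _ hσ hτ.1]

/-- With τ = T†T and w = (1 ⊗ T)v, the left side is ⟪w, (σ ⊗ 1) w⟫ ≤ ‖w‖² because ‖σ‖ ≤ 1, and ‖w‖²
is the right side by orthonormality of the e_i. -/
lemma reductionBound_opTensor {ι : Type*} (e : HilbertBasis ι ℂ C) {σ : C →L[ℂ] C}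
    {τ : A →L[ℂ] A} (hσ : IsState σ) (hτ : τ.IsPositive) :
    ReductionBound e (opTensor σ τ) := by
  classical
  intro F y
  simp_rw [marginalQuad_opTensor e hσ hτ]
  obtain ⟨T, hT, hq⟩ := exists_quad_eq_norm_sq hτ
  have h_norm : ‖σ‖ ≤ 1 := by
    rw [CStarAlgebra.norm_le_one_iff_of_nonneg σ
      ((ContinuousLinearMap.nonneg_iff_isPositive σ).mpr hσ.1)]
    exact hσ.le_one
  set w : HilbertTensor C A := ∑ i ∈ F, ketTensor (e i) (T (y i)) with hw
  have h1 : inner ℂ (∑ i ∈ F, ketTensor (e i) (y i))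
      (opTensor σ τ (∑ i ∈ F, ketTensor (e i) (y i))) = inner ℂ w (opTensor σ 1 w) := by
    simp only [hw, map_sum, sum_inner, inner_sum, opTensor_ketTensor, inner_ketTensor, hT,
      ContinuousLinearMap.comp_apply, ContinuousLinearMap.adjoint_inner_right,
      one_apply_eq_self]
  have h2 : ‖w‖ ^ 2 = ∑ i ∈ F, ‖T (y i)‖ ^ 2 := by
    have h3 : ((‖w‖ ^ 2 : ℝ) : ℂ) = ((∑ i ∈ F, ‖T (y i)‖ ^ 2 : ℝ) : ℂ) := by
      push_cast
      rw [← Complex.coe_algebraMap, ← inner_self_eq_norm_sq_to_K (𝕜 := ℂ), hw]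
      simp only [sum_inner, inner_sum, inner_ketTensor, orthonormal_iff_ite.mp e.orthonormal,
        ite_mul, one_mul, zero_mul, Finset.sum_ite_eq']
      refine Finset.sum_congr rfl fun i hi => ?_
      rw [if_pos hi, inner_self_eq_norm_sq_to_K]
    exact_mod_cast h3
  rw [quad, h1]
  simp_rw [hq]
  rw [← ENNReal.ofReal_sum_of_nonneg fun _ _ => by positivity, ← h2]
  refine ENNReal.ofReal_le_ofReal ?_
  calc (inner ℂ w (opTensor σ 1 w)).re ≤ ‖inner ℂ w (opTensor σ 1 w)‖ := Complex.re_le_norm _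
    _ ≤ ‖w‖ * ‖opTensor σ 1 w‖ := norm_inner_le_norm _ _
    _ ≤ ‖w‖ * (1 * 1 * ‖w‖) := by
      refine mul_le_mul_of_nonneg_left ((norm_opTensor_apply_le σ 1 w).trans ?_) (norm_nonneg _)
      gcongr
      exact ContinuousLinearMap.norm_id_le
    _ = ‖w‖ ^ 2 := by ring

lemma isPositive_real_smul {H : Type*} [NormedAddCommGroup H] [InnerProductSpace ℂ H]
    {T : H →L[ℂ] H} (hT : T.IsPositive) {r : ℝ} (hr : 0 ≤ r) : (r • T).IsPositive := by
  rw [← Complex.coe_smul]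
  exact hT.smul_of_nonneg (Complex.zero_le_real.mpr hr)

omit [CompleteSpace C] [CompleteSpace A] in
lemma convex_isState_reductionBound {ι : Type*} (e : HilbertBasis ι ℂ C) :
    Convex ℝ {ω : HilbertTensor C A →L[ℂ] HilbertTensor C A | IsState ω ∧ ReductionBound e ω} := by
  rintro ω ⟨hω, hω'⟩ χ ⟨hχ, hχ'⟩ a b ha hb hab
  have hq : ∀ x, quad (a • ω + b • χ) x = ENNReal.ofReal a * quad ω x +
      ENNReal.ofReal b * quad χ x := fun x => by
    rw [quad_add (isPositive_real_smul hω.1 ha) (isPositive_real_smul hχ.1 hb),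
      quad_real_smul _ ha, quad_real_smul _ hb]
  have hpos : (a • ω + b • χ).IsPositive :=
    (isPositive_real_smul hω.1 ha).add (isPositive_real_smul hχ.1 hb)
  refine ⟨⟨hpos, ?_⟩, fun F y => ?_⟩
  · rw [posTrace_eq_tsum_quad hpos (basis _)]
    simp_rw [hq]
    rw [ENNReal.tsum_add, ENNReal.tsum_mul_left, ENNReal.tsum_mul_left,
      ← posTrace_eq_tsum_quad hω.1, ← posTrace_eq_tsum_quad hχ.1, hω.2, hχ.2, mul_one, mul_one,
      ← ENNReal.ofReal_add ha hb, hab, ENNReal.ofReal_one]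
  · simp_rw [marginalQuad, hq, ENNReal.tsum_add, ENNReal.tsum_mul_left, Finset.sum_add_distrib,
      ← Finset.mul_sum]
    exact add_le_add (mul_le_mul_right (hω' F y) _) (mul_le_mul_right (hχ' F y) _)

lemma continuous_quad {H : Type*} [NormedAddCommGroup H] [InnerProductSpace ℂ H] (x : H) :
    Continuous fun T : H →L[ℂ] H => quad T x :=
  ENNReal.continuous_ofReal.comp (Complex.continuous_re.comp
    ((innerSL ℂ x).continuous.comp (ContinuousLinearMap.apply ℂ H x).continuous))

omit [CompleteSpace C] in
/-- On states the partial trace is upper semicontinuous, since no mass can be lost. -/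
lemma upperSemicontinuousWithinAt_marginalQuad {ι : Type*} (e : HilbertBasis ι ℂ C)
    {ω : HilbertTensor C A →L[ℂ] HilbertTensor C A} (hω : IsState ω) (y : A) :
    UpperSemicontinuousWithinAt (fun χ => marginalQuad e χ y) {χ | IsState χ} ω := by
  by_cases hy : y = 0
  · have : (fun χ : HilbertTensor C A →L[ℂ] HilbertTensor C A => marginalQuad e χ y) =
        fun _ => 0 := by
      funext χ
      simp [marginalQuad, hy, quad]
    rw [this]
    exact upperSemicontinuousWithinAt_const
  set x : A := ((‖y‖⁻¹ : ℝ) : ℂ) • y with hx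
  have hyn : ‖y‖ ≠ 0 := norm_ne_zero_iff.mpr hy
  have hx1 : ‖x‖ = 1 := by
    rw [hx, norm_smul, Complex.norm_real, norm_inv, norm_norm, inv_mul_cancel₀ hyn]
  have hyx : y = (‖y‖ : ℂ) • x := by
    rw [hx, smul_smul, ← Complex.ofReal_mul, mul_inv_cancel₀ hyn, Complex.ofReal_one, one_smul]
  have ho : Orthonormal ℂ ((↑) : ({x} : Set A) → A) :=
    ⟨by rintro ⟨_, rfl⟩; exact hx1, fun i k hik => absurd (Subsingleton.elim i k) hik⟩
  -- Complete the unit vector x to a basis. For states the marginal at x is 1 minus the sum of the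
  -- marginals at the other basis vectors, and that sum of nonnegative continuous terms is lower
  -- semicontinuous.
  obtain ⟨s, b, hs, hb⟩ := ho.exists_hilbertBasis_extension
  let j : s := ⟨x, hs rfl⟩
  have hj : b j = x := by rw [hb]
  have hsplit : ∀ χ, IsState χ →
      marginalQuad e χ x + ∑' k : {k // k ≠ j}, marginalQuad e χ (b k) = 1 := by
    intro χ hχ
    rw [← hχ.2, posTrace_eq_tsum_marginalQuad e b hχ.1, ← hj,
      ← ENNReal.summable.tsum_add_tsum_compl (s := {j}) ENNReal.summable]
    congr 1
    exact (tsum_singleton j fun k => marginalQuad e χ (b k)).symm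
  have hlsc : LowerSemicontinuous fun χ => ∑' k : {k // k ≠ j}, marginalQuad e χ (b k) :=
    lowerSemicontinuous_tsum fun k => lowerSemicontinuous_tsum fun i =>
      (continuous_quad _).lowerSemicontinuous
  have heq : ∀ χ, IsState χ → marginalQuad e χ y = ENNReal.ofReal (‖y‖ ^ 2) *
      (1 - ∑' k : {k // k ≠ j}, marginalQuad e χ (b k)) := by
    intro χ hχ
    have h1 : marginalQuad e χ y = ENNReal.ofReal (‖y‖ ^ 2) * marginalQuad e χ x := by
      simp_rw [marginalQuad, ← ENNReal.tsum_mul_left]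
      refine tsum_congr fun i => ?_
      conv_lhs => rw [hyx, map_smul, quad_smul]
      simp
    have hne : ∑' k : {k // k ≠ j}, marginalQuad e χ (b k) ≠ ∞ :=
      ne_top_of_le_ne_top ENNReal.one_ne_top (by rw [← hsplit χ hχ]; exact le_add_self)
    rw [h1, ← hsplit χ hχ, ENNReal.add_sub_cancel_right hne]
  have hcont : Continuous fun t : ℝ≥0∞ => ENNReal.ofReal (‖y‖ ^ 2) * (1 - t) :=
    (ENNReal.continuous_const_mul ENNReal.ofReal_ne_top).comp
      (ENNReal.continuous_sub_left ENNReal.one_ne_top)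
  have husc := hcont.comp_lowerSemicontinuous_antitone hlsc fun s t hst =>
    mul_le_mul_right (tsub_le_tsub_left hst 1) _
  intro c hc
  beta_reduce at hc
  rw [heq ω hω] at hc
  filter_upwards [husc.upperSemicontinuousWithinAt {χ | IsState χ} ω c hc,
    self_mem_nhdsWithin] with χ hχ1 hχ2
  rw [heq χ hχ2]
  exact hχ1

/-- A strict violation at ω would persist at all nearby states, the left side being continuous and
the right side upper semicontinuous, but mixtures of product states arbitrarily close to ω satisfy
the bound. -/
lemma IsSeparable.reductionBound {ι : Type*} (e : HilbertBasis ι ℂ C)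
    {ω : HilbertTensor C A →L[ℂ] HilbertTensor C A} (h : IsSeparable ω) : ReductionBound e ω := by
  obtain ⟨hω, hcl⟩ := h
  intro F y
  by_contra! hlt
  obtain ⟨c, hc1, hc2⟩ := exists_between hlt
  have husc : UpperSemicontinuousWithinAt (fun χ => ∑ i ∈ F, marginalQuad e χ (y i))
      {χ | IsState χ} ω :=
    upperSemicontinuousWithinAt_sum fun i _ => upperSemicontinuousWithinAt_marginalQuad e hω (y i)
  have h1 : ∀ᶠ χ in 𝓝 ω, IsState χ → ∑ i ∈ F, marginalQuad e χ (y i) < c :=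
    eventually_nhdsWithin_iff.mp (husc c hc1)
  have h2 := ((continuous_quad (∑ i ∈ F, ketTensor (e i) (y i))).tendsto ω).eventually_const_lt hc2
  obtain ⟨χ, ⟨hχ1, hχ2⟩, hχ⟩ := mem_closure_iff_nhds.mp hcl _ (h1.and h2)
  have h3 : convexHull ℝ (productStates C A) ⊆ {χ | IsState χ ∧ ReductionBound e χ} := by
    refine convexHull_min ?_ (convex_isState_reductionBound e)
    rintro _ ⟨σ, τ, hσ, hτ, rfl⟩
    exact ⟨isState_opTensor hσ hτ, reductionBound_opTensor e hσ hτ.1⟩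
  obtain ⟨hs, hr⟩ := h3 hχ
  exact absurd ((hr F y).trans_lt (hχ1 hs)) hχ2.le.not_gt

end Reduction

/-! ### From the reduction inequality to entropies -/

section Entropy

lemma norm_sq_inner_le_of_isPositive {H : Type u} [NormedAddCommGroup H] [InnerProductSpace ℂ H]
    [CompleteSpace H] {T : H →L[ℂ] H} (hT : T.IsPositive) (x y : H) :
    ‖(inner ℂ x (T y) : ℂ)‖ ^ 2 ≤ (inner ℂ x (T x)).re * (inner ℂ y (T y)).re := by
  obtain ⟨S, rfl, -⟩ := exists_quad_eq_norm_sq hT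
  have e : ∀ z, (inner ℂ z ((S.adjoint ∘L S) z) : ℂ).re = ‖S z‖ ^ 2 := fun z => by
    rw [ContinuousLinearMap.comp_apply, ContinuousLinearMap.adjoint_inner_right]
    exact (norm_sq_eq_re_inner (𝕜 := ℂ) (S z)).symm
  rw [e, e, ContinuousLinearMap.comp_apply, ContinuousLinearMap.adjoint_inner_right, ← mul_pow]
  exact pow_le_pow_left₀ (norm_nonneg _) (norm_inner_le_norm _ _) 2

/-- The quadratic form of an operator that is diagonal in a Hilbert basis. -/
lemma quad_eq_tsum_eigenvalues {H : Type u} [NormedAddCommGroup H] [InnerProductSpace ℂ H]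
    {T : H →L[ℂ] H} (hT : T.IsPositive) {κ : Type*} (f : HilbertBasis κ ℂ H)
    {l : κ → ℝ} (hl0 : ∀ k, 0 ≤ l k) (hl : ∀ k, T (f k) = (l k : ℂ) • f k) (x : H) :
    quad T x = ∑' k, ENNReal.ofReal (l k * ‖inner ℂ (f k) x‖ ^ 2) := by
  have h1 := Complex.hasSum_re (f.hasSum_inner_mul_inner x (T x))
  have e : ∀ k, (inner ℂ x (f k) * inner ℂ (f k) (T x) : ℂ).re = l k * ‖inner ℂ (f k) x‖ ^ 2 := by
    intro k
    rw [← hT.inner_left_eq_inner_right, hl, inner_smul_left, Complex.conj_ofReal,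
      ← inner_conj_symm x (f k), mul_left_comm, ← Complex.normSq_eq_conj_mul_self,
      ← Complex.ofReal_mul, Complex.ofReal_re, Complex.normSq_eq_norm_sq]
  simp_rw [e] at h1
  rw [quad, ← h1.tsum_eq, ENNReal.ofReal_tsum_of_nonneg (fun k => mul_nonneg (hl0 k) (sq_nonneg _))
    h1.summable]

variable {C : Type u} {B : Type v}
  [NormedAddCommGroup C] [InnerProductSpace ℂ C] [CompleteSpace C]
  [NormedAddCommGroup B] [InnerProductSpace ℂ B] [CompleteSpace B]

omit [CompleteSpace C] [CompleteSpace B] in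
/-- If `ω ≤ 1 ⊗ ρ`, then `⟪f, (1 ⊗ (ρ + ε))⁻¹ f⟫ ≤ (l + ε)⁻¹` for a unit eigenvector `f` of `ω`
with eigenvalue `l`. -/
lemma sum_div_le_of_reductionBound {ι κ : Type*} (e : HilbertBasis ι ℂ C)
    {ω : HilbertTensor C B →L[ℂ] HilbertTensor C B} (hω : ω.IsPositive) (hred : ReductionBound e ω)
    {ρ : B →L[ℂ] B} (hρ : ∀ y, marginalQuad e ω y = quad ρ y)
    (g : HilbertBasis κ ℂ B) {m : κ → ℝ} (hm0 : ∀ j, 0 ≤ m j)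
    (hm : ∀ j, ρ (g j) = (m j : ℂ) • g j)
    {f : HilbertTensor C B} (hf : ‖f‖ = 1) {l : ℝ} (hl0 : 0 ≤ l) (hl : ω f = (l : ℂ) • f)
    {ε : ℝ} (hε : 0 < ε) (F : Finset (ι × κ)) :
    ∑ p ∈ F, ‖inner ℂ (tensorBasis e g p) f‖ ^ 2 / (m p.2 + ε) ≤ (l + ε)⁻¹ := by
  classical
  have hmε : ∀ j, 0 < m j + ε := fun j => add_pos_of_nonneg_of_pos (hm0 j) hε
  set a : ι × κ → ℂ := fun p => inner ℂ (tensorBasis e g p) f with ha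
  set I := F.image Prod.fst
  set J := F.image Prod.snd
  -- Enlarging F to a rectangle only increases the sum, and makes the test vector below block-shaped
  -- as in `ReductionBound`.
  have hFIJ : F ⊆ I ×ˢ J := fun p hp => Finset.mem_product.mpr
    ⟨Finset.mem_image_of_mem _ hp, Finset.mem_image_of_mem _ hp⟩
  refine (Finset.sum_le_sum_of_subset_of_nonneg hFIJ fun p _ _ =>
    div_nonneg (sq_nonneg _) (hmε _).le).trans ?_
  set s := ∑ p ∈ I ×ˢ J, ‖a p‖ ^ 2 / (m p.2 + ε) with hs
  have hs0 : 0 ≤ s := Finset.sum_nonneg fun p _ => div_nonneg (sq_nonneg _) (hmε _).le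
  -- These coefficients make v the truncation of (1 ⊗ (ρ + ε))⁻¹ f, so that ⟪f, v⟫ = s.
  let c : ι × κ → ℂ := fun p => a p / ((m p.2 + ε : ℝ) : ℂ)
  have hc : ∀ p, ‖c p‖ ^ 2 = ‖a p‖ ^ 2 / (m p.2 + ε) ^ 2 := fun p => by
    rw [norm_div, Complex.norm_real, Real.norm_of_nonneg (hmε _).le, div_pow]
  let y : ι → B := fun i => ∑ j ∈ J, c (i, j) • g j
  set v : HilbertTensor C B := ∑ i ∈ I, ketTensor (e i) (y i) with hv
  have hv' : v = ∑ p ∈ I ×ˢ J, c p • tensorBasis e g p := by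
    rw [hv, Finset.sum_product]
    simp only [y, map_sum, map_smul, tensorBasis_apply]
  have hfv : inner ℂ f v = (s : ℂ) := by
    rw [hv', inner_sum, hs, Complex.ofReal_sum]
    refine Finset.sum_congr rfl fun p _ => ?_
    rw [inner_smul_right, ← inner_conj_symm, div_mul_eq_mul_div, mul_comm,
      ← Complex.normSq_eq_conj_mul_self, Complex.normSq_eq_norm_sq, ← Complex.ofReal_div]
  have hvv : ‖v‖ ^ 2 = ∑ p ∈ I ×ˢ J, ‖a p‖ ^ 2 / (m p.2 + ε) ^ 2 := by
    rw [hv', norm_sq_eq_re_inner (𝕜 := ℂ), (tensorBasis e g).orthonormal.inner_sum]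
    rw [map_sum]
    refine Finset.sum_congr rfl fun p _ => ?_
    rw [← Complex.normSq_eq_conj_mul_self, ← hc, Complex.normSq_eq_norm_sq]
    exact Complex.ofReal_re _
  have hy : ∀ i, quad ρ (y i) =
      ENNReal.ofReal (∑ j ∈ J, m j * (‖a (i, j)‖ ^ 2 / (m j + ε) ^ 2)) := fun i => by
    have h1 : ρ (y i) = ∑ j ∈ J, (c (i, j) * m j) • g j := by
      simp only [y, map_sum, map_smul, hm, smul_smul]
    rw [quad, h1, g.orthonormal.inner_sum, Complex.re_sum]
    congr 1
    refine Finset.sum_congr rfl fun j _ => ?_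
    rw [← mul_assoc, ← Complex.normSq_eq_conj_mul_self, ← Complex.ofReal_mul, Complex.ofReal_re,
      Complex.normSq_eq_norm_sq, hc, mul_comm]
  have hq : (inner ℂ v (ω v)).re ≤ ∑ p ∈ I ×ˢ J, m p.2 * (‖a p‖ ^ 2 / (m p.2 + ε) ^ 2) := by
    have h1 := hred I y
    simp_rw [hρ, hy] at h1
    rw [← ENNReal.ofReal_sum_of_nonneg fun i _ => Finset.sum_nonneg fun j _ =>
      mul_nonneg (hm0 j) (by positivity), quad, ENNReal.ofReal_le_ofReal_iff
      (Finset.sum_nonneg fun i _ => Finset.sum_nonneg fun j _ =>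
      mul_nonneg (hm0 j) (by positivity))] at h1
    rw [Finset.sum_product]
    exact h1
  -- Cauchy–Schwarz for the form of ω gives l² s² ≤ l ⟪v, ω v⟫; the factor l cancels unless l = 0.
  have hls : l * s ^ 2 ≤ (inner ℂ v (ω v)).re := by
    have h1 := norm_sq_inner_le_of_isPositive hω f v
    have hff : (inner ℂ f (ω f) : ℂ) = (l : ℂ) := by
      rw [hl, inner_smul_right, inner_self_eq_norm_sq_to_K, hf]; simp
    rw [← hω.inner_left_eq_inner_right, hl, inner_smul_left, hfv, Complex.conj_ofReal, ← hl, hff,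
      Complex.ofReal_re, ← Complex.ofReal_mul, Complex.norm_real, Real.norm_eq_abs, sq_abs] at h1
    rcases hl0.eq_or_lt with h0 | h0
    · rw [← h0, zero_mul]
      exact hω.re_inner_nonneg_right v
    · exact le_of_mul_le_mul_left (by linarith) h0
  have hεs : s ^ 2 ≤ ‖v‖ ^ 2 := by
    have h1 := norm_inner_le_norm (𝕜 := ℂ) f v
    rw [hfv, hf, one_mul, Complex.norm_real, Real.norm_of_nonneg hs0] at h1
    exact pow_le_pow_left₀ hs0 h1 2
  -- (l + ε) s² ≤ ⟪v, (ω + ε) v⟫ ≤ ⟪v, (1 ⊗ (ρ + ε)) v⟫ = s.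
  have hfin : (l + ε) * s ^ 2 ≤ s := by
    calc (l + ε) * s ^ 2 = l * s ^ 2 + ε * s ^ 2 := by ring
      _ ≤ ∑ p ∈ I ×ˢ J, m p.2 * (‖a p‖ ^ 2 / (m p.2 + ε) ^ 2) +
          ε * ∑ p ∈ I ×ˢ J, ‖a p‖ ^ 2 / (m p.2 + ε) ^ 2 :=
        add_le_add (hls.trans hq) (mul_le_mul_of_nonneg_left (hεs.trans hvv.le) hε.le)
      _ = s := by
        rw [Finset.mul_sum, ← Finset.sum_add_distrib, hs]
        refine Finset.sum_congr rfl fun p _ => ?_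
        have := (hmε p.2).ne'
        field_simp
  have hlε : 0 < l + ε := add_pos_of_nonneg_of_pos hl0 hε
  rcases hs0.eq_or_lt with h0 | h0
  · rw [← h0]; positivity
  · rw [← one_div, le_div_iff₀ hlε]
    refine le_of_mul_le_mul_left ?_ h0
    linarith

/-- The relative surprisal `log ((1 + ε) / (x + ε))`. -/
def surprisal (ε x : ℝ) : ℝ := Real.log ((1 + ε) / (x + ε))

/-- The numerator 1 + ε serves this sign, which lets all sums be taken in [0, ∞]. -/
lemma surprisal_nonneg {ε x : ℝ} (hε : 0 < ε) (h0 : 0 ≤ x) (h1 : x ≤ 1) : 0 ≤ surprisal ε x :=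
  Real.log_nonneg <| (one_le_div (by positivity)).mpr (by linarith)

/-- This is log t ≤ t - 1 at t = (l + ε) / (x + ε): a bound affine in 1 / (x + ε), ready for
averaging. -/
lemma surprisal_le {ε x l : ℝ} (hε : 0 < ε) (h0 : 0 ≤ x) (hl : 0 ≤ l) :
    surprisal ε x ≤ surprisal ε l - 1 + (l + ε) / (x + ε) := by
  have hx : 0 < x + ε := by positivity
  have hl' : 0 < l + ε := by positivity
  have h1ε : 0 < 1 + ε := by positivity
  have h := Real.log_le_sub_one_of_pos (div_pos hl' hx)
  rw [Real.log_div hl'.ne' hx.ne'] at h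
  rw [surprisal, surprisal, Real.log_div h1ε.ne' hx.ne', Real.log_div h1ε.ne' hl'.ne']
  linarith

/-- Jensen's inequality by tangent line: the weights |⟪e_i ⊗ g_j, f⟫|² sum to 1, and the mean of (l
+ ε) / (m_j + ε) is at most 1, cancelling the -1 in `surprisal_le`. -/
lemma tsum_surprisal_le_of_reductionBound {ι κ : Type*} (e : HilbertBasis ι ℂ C)
    {ω : HilbertTensor C B →L[ℂ] HilbertTensor C B} (hω : ω.IsPositive) (hred : ReductionBound e ω)
    {ρ : B →L[ℂ] B} (hρ : ∀ y, marginalQuad e ω y = quad ρ y)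
    (g : HilbertBasis κ ℂ B) {m : κ → ℝ} (hm0 : ∀ j, 0 ≤ m j) (hm1 : ∀ j, m j ≤ 1)
    (hm : ∀ j, ρ (g j) = (m j : ℂ) • g j)
    {f : HilbertTensor C B} (hf : ‖f‖ = 1) {l : ℝ} (hl0 : 0 ≤ l) (hl : ω f = (l : ℂ) • f)
    {ε : ℝ} (hε : 0 < ε) :
    ∑' p, ENNReal.ofReal (‖inner ℂ (tensorBasis e g p) f‖ ^ 2 * surprisal ε (m p.2)) ≤
      ENNReal.ofReal (surprisal ε l) := by
  set w : ι × κ → ℝ := fun p => ‖inner ℂ (tensorBasis e g p) f‖ ^ 2 with hw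
  have hw0 : ∀ p, 0 ≤ w p := fun p => sq_nonneg _
  have hmε : ∀ j, 0 < m j + ε := fun j => add_pos_of_nonneg_of_pos (hm0 j) hε
  have hbound : ∀ F : Finset (ι × κ), ∑ p ∈ F, w p / (m p.2 + ε) ≤ (l + ε)⁻¹ :=
    sum_div_le_of_reductionBound e hω hred hρ g hm0 hm hf hl0 hl hε
  have hd0 : ∀ p, 0 ≤ w p / (m p.2 + ε) := fun p => div_nonneg (hw0 p) (hmε _).le
  have hds : Summable fun p => w p / (m p.2 + ε) := summable_of_sum_le hd0 hbound
  have hdt : ∑' p, w p / (m p.2 + ε) ≤ (l + ε)⁻¹ := Real.tsum_le_of_sum_le hd0 hbound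
  have hws : HasSum w 1 := by
    have h1 := Complex.hasSum_re ((tensorBasis e g).hasSum_inner_mul_inner f f)
    rw [inner_self_eq_norm_sq_to_K, hf] at h1
    convert h1 using 1
    · funext p
      rw [← inner_conj_symm f, ← Complex.normSq_eq_conj_mul_self, Complex.ofReal_re,
        Complex.normSq_eq_norm_sq]
    · simp
  have hle : ∀ p, w p * surprisal ε (m p.2) ≤
      (surprisal ε l - 1) * w p + (l + ε) * (w p / (m p.2 + ε)) := fun p => by
    calc w p * surprisal ε (m p.2) ≤ w p * (surprisal ε l - 1 + (l + ε) / (m p.2 + ε)) :=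
        mul_le_mul_of_nonneg_left (surprisal_le hε (hm0 _) hl0) (hw0 p)
      _ = _ := by ring
  have hsum := (hws.mul_left (surprisal ε l - 1)).add (hds.hasSum.mul_left (l + ε))
  have hn0 : ∀ p, 0 ≤ w p * surprisal ε (m p.2) := fun p =>
    mul_nonneg (hw0 p) (surprisal_nonneg hε (hm0 _) (hm1 _))
  have hss : Summable fun p => w p * surprisal ε (m p.2) :=
    Summable.of_nonneg_of_le hn0 hle hsum.summable
  rw [← ENNReal.ofReal_tsum_of_nonneg hn0 hss]
  refine ENNReal.ofReal_le_ofReal ((hss.tsum_le_tsum hle hsum.summable).trans ?_)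
  rw [hsum.tsum_eq]
  have hlε : 0 < l + ε := add_pos_of_nonneg_of_pos hl0 hε
  have := mul_le_mul_of_nonneg_left hdt hlε.le
  rw [mul_inv_cancel₀ hlε.ne'] at this
  linarith

/-- Expand m_j = ∑ᵢ ∑ₖ l_k |⟪e_i ⊗ g_j, f_k⟫|², exchange the nonnegative sums, and apply the
single-eigenvector bound for each k. -/
lemma tsum_mul_surprisal_le {ι κ μ : Type*} (e : HilbertBasis ι ℂ C)
    {ω : HilbertTensor C B →L[ℂ] HilbertTensor C B} (hω : ω.IsPositive) (hred : ReductionBound e ω)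
    {ρ : B →L[ℂ] B} (hρ : ∀ y, marginalQuad e ω y = quad ρ y)
    (g : HilbertBasis κ ℂ B) {m : κ → ℝ} (hm0 : ∀ j, 0 ≤ m j) (hm1 : ∀ j, m j ≤ 1)
    (hm : ∀ j, ρ (g j) = (m j : ℂ) • g j)
    (f : HilbertBasis μ ℂ (HilbertTensor C B)) {l : μ → ℝ} (hl0 : ∀ k, 0 ≤ l k)
    (hl : ∀ k, ω (f k) = (l k : ℂ) • f k) {ε : ℝ} (hε : 0 < ε) :
    ∑' j, ENNReal.ofReal (m j * surprisal ε (m j)) ≤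
      ∑' k, ENNReal.ofReal (l k * surprisal ε (l k)) := by
  have hs : ∀ j, 0 ≤ surprisal ε (m j) := fun j => surprisal_nonneg hε (hm0 j) (hm1 j)
  have hmj : ∀ j, ENNReal.ofReal (m j) = ∑' i, ∑' k,
      ENNReal.ofReal (l k * ‖inner ℂ (tensorBasis e g (i, j)) (f k)‖ ^ 2) := fun j => by
    have h1 : quad ρ (g j) = ENNReal.ofReal (m j) := by
      rw [quad, hm, inner_smul_right, inner_self_eq_norm_sq_to_K, g.orthonormal.1 j]; simp
    rw [← h1, ← hρ, marginalQuad]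
    refine tsum_congr fun i => ?_
    rw [quad_eq_tsum_eigenvalues hω f hl0 hl]
    refine tsum_congr fun k => ?_
    rw [tensorBasis_apply, norm_inner_symm]
  calc ∑' j, ENNReal.ofReal (m j * surprisal ε (m j))
      = ∑' j, ∑' i, ∑' k, ENNReal.ofReal (l k * ‖inner ℂ (tensorBasis e g (i, j)) (f k)‖ ^ 2 *
          surprisal ε (m j)) := by
        refine tsum_congr fun j => ?_
        rw [ENNReal.ofReal_mul (hm0 j), hmj, ← ENNReal.tsum_mul_right]
        refine tsum_congr fun i => ?_
        rw [← ENNReal.tsum_mul_right]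
        refine tsum_congr fun k => ?_
        rw [ENNReal.ofReal_mul (mul_nonneg (hl0 k) (sq_nonneg _))]
    _ = ∑' k, ∑' p : ι × κ, ENNReal.ofReal (l k * ‖inner ℂ (tensorBasis e g p) (f k)‖ ^ 2 *
          surprisal ε (m p.2)) := by
        rw [ENNReal.tsum_comm]
        conv_rhs => rw [ENNReal.tsum_comm]
        rw [ENNReal.tsum_prod']
    _ ≤ ∑' k, ENNReal.ofReal (l k * surprisal ε (l k)) := by
        refine ENNReal.tsum_le_tsum fun k => ?_
        rw [ENNReal.ofReal_mul (hl0 k)]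
        refine le_trans (le_of_eq ?_) (mul_le_mul_right
          (tsum_surprisal_le_of_reductionBound e hω hred hρ g hm0 hm1 hm
            (f.orthonormal.1 k) (hl0 k) (hl k) hε) _)
        rw [← ENNReal.tsum_mul_left]
        refine tsum_congr fun p => ?_
        rw [mul_assoc, ENNReal.ofReal_mul (hl0 k)]

/-- The error x log (1 + ε) is linear in x, so over eigenvalues of total mass 1 it adds up to log (1
+ ε). -/
lemma mul_surprisal_le {ε x : ℝ} (hε : 0 < ε) (hx : 0 ≤ x) :
    x * surprisal ε x ≤ x * Real.log (1 + ε) + Real.negMulLog x := by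
  rcases hx.eq_or_lt with rfl | h0
  · simp
  · rw [surprisal, Real.log_div (by positivity) (by positivity), Real.negMulLog]
    have := Real.log_le_log h0 (by linarith : x ≤ x + ε)
    nlinarith

lemma tendsto_mul_surprisal {x : ℝ} (hx : 0 ≤ x) :
    Tendsto (fun ε => x * surprisal ε x) (𝓝[>] 0) (𝓝 (Real.negMulLog x)) := by
  rcases hx.eq_or_lt with rfl | h0
  · simp
  · have h1 : ContinuousAt (fun ε => x * surprisal ε x) 0 := by
      unfold surprisal
      refine continuousAt_const.mul (ContinuousAt.log ?_ ?_)
      · exact ContinuousAt.div (by fun_prop) (by fun_prop) (by simpa using h0.ne')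
      · simpa using h0.ne'
    have h2 := h1.tendsto.mono_left (nhdsWithin_le_nhds (s := Set.Ioi 0))
    simpa [surprisal, Real.negMulLog] using h2

/-- The entropy comparison obtained from the surprisal comparison in the limit `ε → 0`. -/
lemma tsum_negMulLog_le_of_surprisal {κ μ : Type*} {m : κ → ℝ} {l : μ → ℝ} (hm0 : ∀ j, 0 ≤ m j)
    (hl0 : ∀ k, 0 ≤ l k) (hl1 : ∀ k, l k ≤ 1) (hl : ∑' k, ENNReal.ofReal (l k) = 1)
    (h : ∀ ε > 0, ∑' j, ENNReal.ofReal (m j * surprisal ε (m j)) ≤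
      ∑' k, ENNReal.ofReal (l k * surprisal ε (l k))) :
    ∑' j, ENNReal.ofReal (Real.negMulLog (m j)) ≤ ∑' k, ENNReal.ofReal (Real.negMulLog (l k)) := by
  have hbound : ∀ ε > 0, ∑' j, ENNReal.ofReal (m j * surprisal ε (m j)) ≤
      ENNReal.ofReal (Real.log (1 + ε)) + ∑' k, ENNReal.ofReal (Real.negMulLog (l k)) := by
    intro ε hε
    have hlog : 0 ≤ Real.log (1 + ε) := Real.log_nonneg (by linarith)
    calc _ ≤ _ := h ε hε
      _ ≤ ∑' k, (ENNReal.ofReal (l k) * ENNReal.ofReal (Real.log (1 + ε)) +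
          ENNReal.ofReal (Real.negMulLog (l k))) := by
        refine ENNReal.tsum_le_tsum fun k => ?_
        rw [← ENNReal.ofReal_mul (hl0 k), ← ENNReal.ofReal_add (mul_nonneg (hl0 k) hlog)
          (Real.negMulLog_nonneg (hl0 k) (hl1 k))]
        exact ENNReal.ofReal_le_ofReal (mul_surprisal_le hε (hl0 k))
      _ = _ := by rw [ENNReal.tsum_add, ENNReal.tsum_mul_right, hl, one_mul]
  -- Passing to finite partial sums on the left makes the limit ε → 0 termwise, as in Fatou's lemma.
  rw [ENNReal.tsum_eq_iSup_sum]
  refine iSup_le fun F => ?_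
  have h1 : Tendsto (fun ε => ∑ j ∈ F, ENNReal.ofReal (m j * surprisal ε (m j))) (𝓝[>] 0)
      (𝓝 (∑ j ∈ F, ENNReal.ofReal (Real.negMulLog (m j)))) :=
    tendsto_finsetSum _ fun j _ => ENNReal.tendsto_ofReal (tendsto_mul_surprisal (hm0 j))
  have h2 : Tendsto (fun ε => ENNReal.ofReal (Real.log (1 + ε)) +
      ∑' k, ENNReal.ofReal (Real.negMulLog (l k))) (𝓝[>] 0)
      (𝓝 (0 + ∑' k, ENNReal.ofReal (Real.negMulLog (l k)))) := by
    refine Tendsto.add ?_ tendsto_const_nhds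
    have h3 : ContinuousAt (fun ε : ℝ => Real.log (1 + ε)) 0 :=
      ContinuousAt.log (by fun_prop) (by simp)
    have h4 := ENNReal.tendsto_ofReal
      (h3.tendsto.mono_left (nhdsWithin_le_nhds (s := Set.Ioi 0)))
    simpa using h4
  rw [zero_add] at h2
  refine le_of_tendsto_of_tendsto h1 h2 ?_
  filter_upwards [self_mem_nhdsWithin] with ε hε
  exact (ENNReal.sum_le_tsum F).trans (hbound ε hε)

/-- The reduction bound implies that the entropy of a marginal is at most that of the whole. -/
lemma vonNeumannEntropy_le_of_reductionBound {ι : Type*} (e : HilbertBasis ι ℂ C)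
    {ω : HilbertTensor C B →L[ℂ] HilbertTensor C B} (hω : IsState ω) (hred : ReductionBound e ω)
    {ρ : B →L[ℂ] B} (hρs : IsState ρ) (hρ : ∀ y, marginalQuad e ω y = quad ρ y) :
    vonNeumannEntropy ρ ≤ vonNeumannEntropy ω := by
  obtain ⟨κ, g, m, hm, hm0, hm1, -, hSm⟩ := hρs.exists_eigenbasis
  obtain ⟨μ, f, l, hl, hl0, hl1, hlsum, hSl⟩ := hω.exists_eigenbasis
  have h := tsum_negMulLog_le_of_surprisal hm0 hl0 hl1 hlsum fun ε hε =>
    tsum_mul_surprisal_le e hω.1 hred hρ g hm0 hm1 hm f hl0 hl hε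
  have hlog : 0 < Real.log 2 := Real.log_pos one_lt_two
  rw [hSm, hSl]
  simp_rw [ENNReal.ofReal_div_of_pos hlog, div_eq_mul_inv, ENNReal.tsum_mul_right]
  exact mul_le_mul_left h _

end Entropy

end QInfo

end

/-! ### The coherent information bound -/

theorem mainTheorem3
    {A B C : Type*}
    [NormedAddCommGroup A] [InnerProductSpace ℂ A] [CompleteSpace A]
    [NormedAddCommGroup B] [InnerProductSpace ℂ B] [CompleteSpace B]
    [NormedAddCommGroup C] [InnerProductSpace ℂ C] [CompleteSpace C]
    (Ξ : QInfo.QuantumChannel A B)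
    (ρA : QInfo.traceClass A) (hρA : QInfo.IsState (ρA : A →L[ℂ] A))
    (ψ : QInfo.HilbertTensor C A) (hψ : QInfo.IsPurification ψ (ρA : A →L[ℂ] A))
    (hsep : QInfo.IsSeparable (Ξ.idTensor (QInfo.pureState ψ))) :
    Ξ.coherentInformation ρA ψ ≤ 0 := by
  -- A state has trace one, so ρ_CB is not the default value 0 of a divergent sum.
  have hne : Ξ.idTensor (QInfo.pureState ψ) ≠ 0 := fun h0 => by
    have := hsep.1.2
    simp [h0, QInfo.posTrace] at this
  have hB : QInfo.IsState (Ξ.apply ρA) :=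
    ⟨Ξ.isPositive_apply hρA.1, (Ξ.tracePreserving ρA hρA.1).trans hρA.2⟩
  have h := QInfo.vonNeumannEntropy_le_of_reductionBound (QInfo.basis C) hsep.1
    (hsep.reductionBound _) hB (Ξ.marginalQuad_idTensor hρA hψ hne)
  rw [QInfo.QuantumChannel.coherentInformation]
  -- Replace S(ρ_B) by S(ρ_CB); the difference S(ρ_CB) - S(ρ_CB) is 0, or -∞ when the entropy is
  -- infinite.
  refine (EReal.sub_le_sub (EReal.coe_ennreal_le_coe_ennreal_iff.mpr h) le_rfl).trans ?_
  exact EReal.sub_self_le_zero
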